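/- **Setting.** Let $G$ be a discrete group and $O_G$ the category of orbits $G/H$ ($H\le G$) and $G$-maps $\hat g:G/H\to G/K$, $\hat g(eH)=gK$, $g^{-1}Hg\subseteq K$. Let $X$ be a $G$-simplicial set which is $G$-connected (every fixed point simplicial set $X^H$ is connected), with a $G$-fixed vertex $v\in X_0$. An equivariant $n$-simplex of type $H$ of $X$ is a $G$-simplicial map $\sigma:G/H\times\Delta[n]\to X$; it corresponds to the $n$-simplex $\sigma'=\sigma(eH,\Delta_n)$ of $X^H$ and is degenerate if $\sigma'$ is. Put $\sigma^{(j)}=\sigma\circ(\mathrm{id}\times\delta_j)$, and let $\sigma_H=\sigma\circ(\mathrm{id}\times\delta_{(1,\dots,n)})$ be the restriction of $\sigma$ to the vertex $0$ of $\Delta[n]$. *Fundamental groupoid and coefficients.* $\Pi X=\Pi S|X|$ is the category whose objects are the equivariant $0$-simplices $x_H$ of $S|X|$ of all types, and whose morphisms $x_H\to y_K$ are classes $[\hat g,\phi]$ of a $G$-map $\hat g:G/H\to G/K$ and an equivariant $1$-simplex $\phi$ of $S|X|$ of type $H$ from $x_H$ to $y_K\circ(\hat g\times \mathrm{id})$,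 modulo $G$-homotopy of $\phi$ relative to $G/H\times\partial\Delta[1]$; composition is composition of the $G$-maps and concatenation of the $1$-simplices. Equivariant simplices of $X$ are regarded as simplices of $S|X|$ by the unit $X\to S|X|$. Let $M$ be an equivariant local coefficient system on $X$, i.e. a contravariant functor $\Pi X\to\mathrm{Ab}$. *Bredon–Illman cohomology.* $S^n_G(X;M)$ is the group of functions $f$ which assign to each equivariant $n$-simplex $\sigma$ of $X$ of any type $H$ an element $f(\sigma)\in M(\sigma_H)$, with $f(\sigma)=0$ if $\sigma$ is degenerate, and $f(\eta)=M(g_*)f(\tau)$ whenever $\eta=\tau\circ(\hat g\times\mathrm{id})$ for a $G$-map $\hat g:G/H\to G/K$, where $g_*=[\hat g,k]:\eta_H\to\tau_K$ with $k$ constant. The coboundary is $$(\delta f)(\sigma)=M(\sigma_*)f(\sigma^{(0)})+\sum_{j=1}^{n+1}(-1)^jf(\sigma^{(j)}),$$ where $\sigma_*=[\mathrm{id},\sigma\circ(\mathrm{id}\times\delta_{(2,\dots,n+1)})]:\sigma_H\to\sigma^{(0)}_H$ is given by the edge of $\sigma$ from the vertex $0$ to the vertex $1$ (and $\sigma^{(j)}_H=\sigma_H$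 for $j\ge1$). Put $H^n_G(X;M)=H^n(S_G^*(X;M),\delta)$. *Twisted cohomology.* $\Phi X$ is the $O_G$-simplicial set $G/H\mapsto X^H$, and $\underline\pi X$ is the $O_G$-group $G/H\mapsto\pi_1(X^H,v)$ (the fundamental group of $S|X^H|$, with product the composition of morphisms in the fundamental groupoid $\pi X^H$), also regarded as a constant $O_G$-group complex. For a morphism $\xi:x\to y$ of $\pi X^H$, $\xi=[\bar\omega]$, let $b\xi=[\mathrm{id},\omega]:x_H\to y_H$ be the corresponding morphism of $\Pi X$. Let $v_H$ be the equivariant $0$-simplex of type $H$ with value $v$. Let $M_0$ be the abelian $O_G$-group $M_0(G/H)=M(v_H)$, $M_0(\hat g)=M([\hat g,k])$, $k$ constant, and let $\phi$ be the action of $\underline\pi X$ on $M_0$ in which $\alpha\in\pi_1(X^H,v)$ acts on $M(v_H)$ as $M(b\alpha)^{-1}$. Choose a vertex $x$ in each $G$-orbit of $X_0$ and, for each chosen $x$, a $1$-simplex $\omega_x$ of $S|X^{G_x}|$ from $v$ to $x$ ($\partial_1\omega_x=v$, $\partial_0\omega_x=x$), where $G_x$ is the stabilizer. Put $\omega_{gx}=g\omega_x$,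 and for a vertex $x$ of $X^H$ let $\xi_H(x)=[\bar\omega_x]:v\to x$ in $\pi X^H$. Let $\kappa:\Phi X\to\underline\pi X$ be the $O_G$-twisting function $$\kappa(G/H)_n(y)=\xi_H(\partial_{(0,2,\dots,n)}y)^{-1}\circ[\overline{\partial_{(2,\dots,n)}y}]\circ\xi_H(\partial_{(1,\dots,n)}y),\qquad y\in(X^H)_n,\ n\ge1 .$$ Let $C_n(X^H;\mathbb Z)$ be the free abelian group on the non-degenerate $n$-simplices of $X^H$ (degenerate simplices being $0$), let $C^n_G(X;\kappa,\phi)$ be the group of natural transformations $f$ from $G/H\mapsto C_n(X^H;\mathbb Z)$ to $M_0$, with $$(\delta_\kappa f)(G/H)(x)=\kappa(G/H)_{n+1}(x)^{-1}f(G/H)(\partial_0x)+\sum_{i=1}^{n+1}(-1)^if(G/H)(\partial_ix),\qquad x\in (X^H)_{n+1},$$ and put $H^n_G(X;\kappa,\phi)=H^n(C^*_G(X;\kappa,\phi),\delta_\kappa)$. **Theorem 4.7.** Choices of vertices $x$ and $1$-simplices $\omega_x$ as above exist, and for each such choice the following holds. There are mutually inverse isomorphisms of cochain complexes $$\Psi^*:S^*_G(X;M)\to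 C^*_G(X;\kappa,\phi),\qquad \Gamma^*:C^*_G(X;\kappa,\phi)\to S^*_G(X;M)$$ such that, for all $n\ge0$ and every non-degenerate equivariant $n$-simplex $\sigma$ of any type $H$, with $y=\sigma(eH,\Delta_n)$, $$\Psi^n(f)(G/H)(y)=M\bigl(b\,\xi_H(\partial_{(1,\dots,n)}y)\bigr)f(\sigma)\quad(f\in S^n_G(X;M)),$$ $$\Gamma^n(f)(\sigma)=M\bigl(b\,\xi_H(\partial_{(1,\dots,n)}y)^{-1}\bigr)f(G/H)(y)\quad(f\in C^n_G(X;\kappa,\phi)).$$ Consequently $\Psi^*$ induces an isomorphism $$H^n_G(X;M)\;\cong\;H^n_G(X;\kappa,\phi)\qquad\text{for all } n\ge 0 .$$ -/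

import Mathlib

open CategoryTheory Simplicial Opposite
universe u
noncomputable section
namespace EqLC

/-! ### The orbit category -/

/-- Objects of the category of canonical orbits: the orbit `G ⧸ H`, for `H` a subgroup of `G`. -/
structure Orb (G : Type u) [Group G] where
  /-- the subgroup `H` -/
  sub : Subgroup G

variable {G : Type u} [Group G]

/-- The orbit `G ⧸ H` itself. -/
abbrev Orb.coset (U : Orb G) : Type u := G ⧸ U.sub

/-- The base point `eH` of `G ⧸ H`. -/
abbrev Orb.base (U : Orb G) : U.coset := QuotientGroup.mk 1

/-- Morphisms are the `G`-maps `G ⧸ H → G ⧸ K`. -/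
instance : Category (Orb G) where
  Hom U V := U.coset →[G] V.coset
  id U := MulActionHom.id G
  comp f g := MulActionHom.comp g f

/-- A `G`-map between orbits, as a function. -/
def Orb.fn {U V : Orb G} (f : U ⟶ V) : U.coset → V.coset :=
  fun a => (show U.coset →[G] V.coset from f) a

lemma Orb.fn_smul {U V : Orb G} (f : U ⟶ V) (g : G) (a : U.coset) :
    Orb.fn f (g • a) = g • Orb.fn f a :=
  map_smul (show U.coset →[G] V.coset from f) g a

@[simp] lemma Orb.fn_id (U : Orb G) (a : U.coset) : Orb.fn (𝟙 U) a = a := rfl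

@[simp] lemma Orb.fn_comp {U V W : Orb G} (f : U ⟶ V) (g : V ⟶ W) (a : U.coset) :
    Orb.fn (f ≫ g) a = Orb.fn g (Orb.fn f a) := rfl

lemma Orb.mk_eq_smul (U : Orb G) (g : G) : (QuotientGroup.mk g : U.coset) = g • U.base := by
  change _ = (QuotientGroup.mk (g * 1) : U.coset)
  rw [mul_one]

lemma Orb.hom_ext {U V : Orb G} {f f' : U ⟶ V} (h : Orb.fn f U.base = Orb.fn f' U.base) :
    f = f' := by
  refine MulActionHom.ext fun a => ?_
  obtain ⟨g, rfl⟩ := QuotientGroup.mk_surjective a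
  change Orb.fn f _ = Orb.fn f' _
  rw [Orb.mk_eq_smul, Orb.fn_smul, Orb.fn_smul, h]

/-- The morphism `G ⧸ H → G ⧸ K`, `eH ↦ gK`, for a subconjugacy relation `g⁻¹ H g ⊆ K`. -/
def Orb.ofElt {U V : Orb G} (g : G) (h : ∀ a ∈ U.sub, g⁻¹ * a * g ∈ V.sub) : U ⟶ V :=
  show U.coset →[G] V.coset from
  { toFun := Quotient.lift (fun x : G => (QuotientGroup.mk (x * g) : V.coset)) (by
      intro a b hab
      have hab' := QuotientGroup.leftRel_apply.1 hab
      refine QuotientGroup.eq.2 ?_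
      have := h _ hab'
      simpa [mul_assoc] using this)
    map_smul' := by
      rintro x a
      obtain ⟨y, rfl⟩ := QuotientGroup.mk_surjective a
      change (QuotientGroup.mk (x * y * g) : V.coset) = QuotientGroup.mk (x * (y * g))
      rw [mul_assoc] }

lemma Orb.fn_ofElt {U V : Orb G} (g : G) (h : ∀ a ∈ U.sub, g⁻¹ * a * g ∈ V.sub) :
    Orb.fn (Orb.ofElt (U := U) (V := V) g h) U.base = QuotientGroup.mk g := by
  change (QuotientGroup.mk (1 * g) : V.coset) = _
  rw [one_mul]

/-- An element `g` with `f (eH) = gK`. -/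
def Orb.elt {U V : Orb G} (f : U ⟶ V) : G := Quotient.out (Orb.fn f U.base)

lemma Orb.mk_elt {U V : Orb G} (f : U ⟶ V) :
    (QuotientGroup.mk (Orb.elt f) : V.coset) = Orb.fn f U.base := Quotient.out_eq _

lemma Orb.elt_conj {U V : Orb G} (f : U ⟶ V) (a : G) (ha : a ∈ U.sub) :
    (Orb.elt f)⁻¹ * a * Orb.elt f ∈ V.sub := by
  have h1 : a • Orb.fn f U.base = Orb.fn f U.base := by
    rw [← Orb.fn_smul]
    congr 1
    rw [← Orb.mk_eq_smul]
    exact QuotientGroup.eq.2 (by simpa using U.sub.inv_mem ha)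
  rw [← Orb.mk_elt] at h1
  have h2 : (QuotientGroup.mk (a * Orb.elt f) : V.coset) = QuotientGroup.mk (Orb.elt f) := h1
  have := QuotientGroup.eq.1 h2.symm
  simpa [mul_assoc] using this

/-! ### `G`-simplicial sets -/

/-- A `G`-simplicial set: a simplicial set with a (left) action of `G` by simplicial maps. -/
abbrev GSSet (G : Type u) [Group G] := Action SSet.{u} G

namespace GSSet
variable (X : GSSet G)

/-- The action of `g` on simplices. -/
def act (g : G) {n : SimplexCategoryᵒᵖ} (x : X.V.obj n) : X.V.obj n :=
  (show X.V ⟶ X.V from X.ρ g).app n x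

lemma act_one {n : SimplexCategoryᵒᵖ} (x : X.V.obj n) : X.act 1 x = x := by
  unfold act
  rw [show (show X.V ⟶ X.V from X.ρ 1) = 𝟙 X.V from X.ρ.map_one]
  rfl

lemma act_mul (g h : G) {n : SimplexCategoryᵒᵖ} (x : X.V.obj n) :
    X.act (g * h) x = X.act g (X.act h x) := by
  unfold act
  rw [show (show X.V ⟶ X.V from X.ρ (g * h)) =
    (show X.V ⟶ X.V from X.ρ h) ≫ (show X.V ⟶ X.V from X.ρ g) from X.ρ.map_mul g h]
  rfl

lemma act_map (g : G) {n m : SimplexCategoryᵒᵖ} (f : n ⟶ m) (x : X.V.obj n) :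
    X.act g (X.V.map f x) = X.V.map f (X.act g x) :=
  NatTrans.naturality_apply (show X.V ⟶ X.V from X.ρ g) f x

/-- The fixed point simplicial set `X^H`, as a subcomplex. -/
def fixed (H : Subgroup G) : X.V.Subcomplex where
  obj n := {x | ∀ h ∈ H, X.act h x = x}
  map f x hx h hh := by
    rw [act_map, hx h hh]

/-- The stabilizer `G_x`. -/
def stab {n : SimplexCategoryᵒᵖ} (x : X.V.obj n) : Subgroup G where
  carrier := {g | X.act g x = x}
  one_mem' := X.act_one x
  mul_mem' {a b} ha hb := by
    have ha : X.act a x = x := ha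
    have hb : X.act b x = x := hb
    change X.act (a * b) x = x
    rw [act_mul, hb, ha]
  inv_mem' {a} ha := by
    have ha : X.act a x = x := ha
    change X.act a⁻¹ x = x
    conv_lhs => rw [← ha]
    rw [← act_mul, inv_mul_cancel, act_one]

/-- `X` is `G`-connected: every fixed point simplicial set is connected. -/
def GConnected : Prop := ∀ H : Subgroup G, (X.fixed H : SSet.{u}).IsConnected

lemma act_eq_of_mk_eq {V : Orb G} {g g' : G}
    (h : (QuotientGroup.mk g : V.coset) = QuotientGroup.mk g')
    {n : SimplexCategoryᵒᵖ} (x : X.V.obj n) (hx : x ∈ (X.fixed V.sub).obj n) :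
    X.act g x = X.act g' x := by
  have := hx _ (QuotientGroup.eq.1 h)
  conv_lhs => rw [← this]
  rw [← act_mul, mul_inv_cancel_left]

/-- For `f : G ⧸ H → G ⧸ K`, `f (eH) = gK`, the simplicial map `g : X^K → X^H`, `x ↦ g x`. -/
def fixedMap {U V : Orb G} (f : U ⟶ V) :
    (X.fixed V.sub : SSet.{u}) ⟶ (X.fixed U.sub : SSet.{u}) :=
  SSet.Subcomplex.lift ((X.fixed V.sub).ι ≫ (show X.V ⟶ X.V from X.ρ (Orb.elt f))) (by
    rintro n _ ⟨x, rfl⟩ a ha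
    change X.act a (X.act (Orb.elt f) x.1) = X.act (Orb.elt f) x.1
    have h1 := x.2 _ (Orb.elt_conj f a ha)
    conv_rhs => rw [← h1]
    rw [← act_mul, ← act_mul]
    congr 1
    group)

lemma fixedMap_val {U V : Orb G} (f : U ⟶ V) {n : SimplexCategoryᵒᵖ}
    (x : (X.fixed V.sub : SSet.{u}).obj n) :
    ((X.fixedMap f).app n x).1 = X.act (Orb.elt f) x.1 := rfl

lemma fixedMap_val' {U V : Orb G} (f : U ⟶ V) (g : G)
    (hg : Orb.fn f U.base = QuotientGroup.mk g) {n : SimplexCategoryᵒᵖ}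
    (x : (X.fixed V.sub : SSet.{u}).obj n) :
    ((X.fixedMap f).app n x).1 = X.act g x.1 := by
  rw [fixedMap_val]
  exact X.act_eq_of_mk_eq (V := V) ((Orb.mk_elt f).trans hg) x.1 x.2

/-- The `O_G`-simplicial set `ΦX`, `G ⧸ H ↦ X^H`. -/
def Phi : (Orb G)ᵒᵖ ⥤ SSet.{u} where
  obj U := (X.fixed U.unop.sub : SSet.{u})
  map f := X.fixedMap f.unop
  map_id U := by
    ext n x
    apply Subtype.ext
    refine (X.fixedMap_val' (𝟙 U.unop) 1 rfl x).trans ?_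
    rw [act_one]
    rfl
  map_comp {U V W} f g := by
    ext n x
    apply Subtype.ext
    refine (X.fixedMap_val' (g.unop ≫ f.unop) (Orb.elt g.unop * Orb.elt f.unop) ?_ x).trans ?_
    · rw [Orb.fn_comp, ← Orb.mk_elt g.unop, Orb.mk_eq_smul, Orb.fn_smul, ← Orb.mk_elt f.unop]
      rfl
    · rw [act_mul]
      rfl

end GSSet

/-! ### Equivariant simplices -/

/-- The `G`-simplicial set `G ⧸ H × Δ[n]`, with `G` acting on the first factor. -/
def orbitSimplex (U : Orb G) (n : SimplexCategory) : GSSet G where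
  V :=
    { obj := fun m => U.coset × (SSet.stdSimplex.{u}.obj n).obj m
      map := fun f => ↾fun p => (p.1, (SSet.stdSimplex.{u}.obj n).map f p.2)
      map_id := fun m => by ext p <;> simp
      map_comp := fun f g => by ext p <;> simp }
  ρ :=
    { toFun := fun g =>
        { app := fun m => ↾fun p => (g • p.1, p.2)
          naturality := fun _ _ f => by ext p <;> rfl }
      map_one' := by
        refine SSet.hom_ext fun m => ?_
        ext p
        · exact one_smul G p.1
        · rfl
      map_mul' := fun g h => by
        refine SSet.hom_ext fun m => ?_
        ext p
        · exact mul_smul g h p.1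
        · rfl }

/-- The `G`-map `f × θ : G ⧸ H × Δ[m] → G ⧸ K × Δ[n]`. -/
def orbitSimplexMap {U V : Orb G} (f : U ⟶ V) {m n : SimplexCategory} (θ : m ⟶ n) :
    orbitSimplex U m ⟶ orbitSimplex V n where
  hom :=
    { app := fun k => ↾fun p => (Orb.fn f p.1, (SSet.stdSimplex.{u}.map θ).app k p.2)
      naturality := fun _ _ a => by
        ext p
        exact congrArg (fun b => (Orb.fn f p.1, b))
          (NatTrans.naturality_apply (SSet.stdSimplex.{u}.map θ) a p.2) }
  comm g := by
    ext k p
    exact Prod.ext (Orb.fn_smul f g p.1) rfl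

lemma orbitSimplexMap_comp {U V W : Orb G} (f : U ⟶ V) (f' : V ⟶ W) {l m n : SimplexCategory}
    (θ : l ⟶ m) (θ' : m ⟶ n) :
    orbitSimplexMap f θ ≫ orbitSimplexMap f' θ' = orbitSimplexMap (f ≫ f') (θ ≫ θ') := by
  apply Action.Hom.ext
  ext k p
  refine Prod.ext rfl ?_
  exact congrArg (fun φ : SSet.stdSimplex.{u}.obj l ⟶ SSet.stdSimplex.{u}.obj n =>
    φ.app k (show U.coset × _ from p).2) (SSet.stdSimplex.{u}.map_comp θ θ').symm

/-- Equivariant `n`-simplices of type `H` in `X`: `G`-simplicial maps `G ⧸ H × Δ[n] → X`. -/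
abbrev ESimplex (X : GSSet G) (U : Orb G) (n : ℕ) := orbitSimplex U ⦋n⦌ ⟶ X

namespace ESimplex
variable {X : GSSet G} {U V W : Orb G} {l m n : ℕ}

/-- The `n`-simplex `(a, Δₙ)` of `G ⧸ H × Δ[n]`. -/
def top (U : Orb G) (n : ℕ) (a : U.coset) : (orbitSimplex U ⦋n⦌).V _⦋n⦌ :=
  show U.coset × (SSet.stdSimplex.{u}.obj ⦋n⦌).obj (op ⦋n⦌) from
    (a, SSet.stdSimplex.objEquiv.symm (𝟙 ⦋n⦌))

/-- The value `σ (a, Δₙ)`. -/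
def val (σ : ESimplex X U n) (a : U.coset) : X.V _⦋n⦌ :=
  σ.hom.app (op ⦋n⦌) (top U n a)

/-- Precomposition `σ ∘ (id × θ)`. -/
def face (σ : ESimplex X V n) (θ : ⦋m⦌ ⟶ ⦋n⦌) : ESimplex X V m := orbitSimplexMap (𝟙 V) θ ≫ σ

/-- Precomposition `σ ∘ (f × id)`. -/
def along (σ : ESimplex X V n) (f : U ⟶ V) : ESimplex X U n := orbitSimplexMap f (𝟙 ⦋n⦌) ≫ σ


lemma face_face (σ : ESimplex X V n) (θ : ⦋m⦌ ⟶ ⦋n⦌) (θ' : ⦋l⦌ ⟶ ⦋m⦌) :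
    (σ.face θ).face θ' = σ.face (θ' ≫ θ) := by
  unfold face
  rw [← Category.assoc, orbitSimplexMap_comp]
  rfl

lemma along_face (σ : ESimplex X V n) (f : U ⟶ V) (θ : ⦋m⦌ ⟶ ⦋n⦌) :
    (σ.along f).face θ = (σ.face θ).along f := by
  unfold face along
  rw [← Category.assoc, orbitSimplexMap_comp, ← Category.assoc, orbitSimplexMap_comp]
  rfl

lemma val_face (σ : ESimplex X V n) (θ : ⦋m⦌ ⟶ ⦋n⦌) (a : V.coset) :
    (σ.face θ).val a = X.V.map θ.op (σ.val a) := by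
  refine Eq.trans ?_ (NatTrans.naturality_apply σ.hom θ.op (top V n a))
  change σ.hom.app (op ⦋m⦌) _ = σ.hom.app (op ⦋m⦌) _
  congr 1

lemma val_along (σ : ESimplex X V n) (f : U ⟶ V) (a : U.coset) :
    (σ.along f).val a = σ.val (Orb.fn f a) := by
  change σ.hom.app (op ⦋n⦌) _ = σ.hom.app (op ⦋n⦌) _
  congr 1

lemma val_smul (σ : ESimplex X V n) (g : G) (a : V.coset) :
    σ.val (g • a) = X.act g (σ.val a) := by
  have h := congrArg (fun φ => φ.app (op ⦋n⦌) (top V n a)) (σ.comm g)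
  exact h

/-- The simplex `σ' = σ (eH, Δₙ)` of `X^H`. -/
def simplex (σ : ESimplex X U n) : (X.fixed U.sub : SSet.{u}) _⦋n⦌ :=
  ⟨σ.val U.base, fun h hh => by
    rw [← val_smul]
    congr 1
    rw [← Orb.mk_eq_smul]
    exact QuotientGroup.eq.2 (by simpa using U.sub.inv_mem hh)⟩

lemma simplex_face (σ : ESimplex X V n) (θ : ⦋m⦌ ⟶ ⦋n⦌) :
    (σ.face θ).simplex = (X.fixed V.sub : SSet.{u}).map θ.op σ.simplex :=
  Subtype.ext (σ.val_face θ _)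

lemma simplex_along (σ : ESimplex X V n) (f : U ⟶ V) :
    (σ.along f).simplex = (X.fixedMap f).app _ σ.simplex := by
  apply Subtype.ext
  refine (σ.val_along f _).trans ?_
  refine Eq.trans ?_ (X.fixedMap_val f _).symm
  rw [← Orb.mk_elt, Orb.mk_eq_smul, val_smul]
  rfl
end ESimplex
/-! ### Geometric realization -/

section Realization
variable {S T : SSet.{u}} {m n : ℕ}

/-- The characteristic map `Δⁿ → |S|` of an `n`-simplex of `S`; it is the image of the simplex
under the unit `S → S|S|`. -/
def chi (s : S _⦋n⦌) : C(stdSimplex ℝ (Fin (n + 1)), |S|) :=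
  TopCat.toSSetObjEquiv |S| (op ⦋n⦌) ((sSetTopAdj.unit.app S).app (op ⦋n⦌) s)

lemma chi_map (θ : ⦋m⦌ ⟶ ⦋n⦌) (s : S _⦋n⦌) (z : stdSimplex ℝ (Fin (m + 1))) :
    chi (S.map θ.op s) z = chi s (stdSimplex.map θ z) := by
  have h := NatTrans.naturality_apply (sSetTopAdj.unit.app S) θ.op s
  exact congrArg (fun w => TopCat.toSSetObjEquiv |S| (op ⦋m⦌) w z) h

lemma map_chi (f : S ⟶ T) (s : S _⦋n⦌) (z : stdSimplex ℝ (Fin (n + 1))) :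
    SSet.toTop.map f (chi s z) = chi (f.app _ s) z := by
  have h := congrArg (fun φ => φ.app (op ⦋n⦌) s) (sSetTopAdj.unit.naturality f)
  have h2 := congrArg (fun w => TopCat.toSSetObjEquiv |T| (op ⦋n⦌) w z) h
  exact h2.symm

/-- The point of `|S|` given by a `0`-simplex. -/
def pt (x : S _⦋0⦌) : |S| := chi x (stdSimplex.vertex (0 : Fin 1))

lemma chi_zero (x : S _⦋0⦌) (z : stdSimplex ℝ (Fin 1)) : chi x z = pt x :=
  congrArg (chi x) (Subsingleton.elim _ _)

lemma map_pt (f : S ⟶ T) (x : S _⦋0⦌) : SSet.toTop.map f (pt x) = pt (f.app _ x) := map_chi f x _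

lemma chi_vertex (s : S _⦋n⦌) (i : Fin (n + 1)) :
    chi s (stdSimplex.vertex i) = pt (S.map (SimplexCategory.const ⦋0⦌ ⦋n⦌ i).op s) := by
  unfold pt
  rw [chi_map, stdSimplex.map_vertex]
  rfl

/-- The segment from the vertex `0` to the vertex `1` of `Δ¹`. -/
def unitPath : Path (stdSimplex.vertex 0 : stdSimplex ℝ (Fin 2)) (stdSimplex.vertex 1) where
  toFun := stdSimplexHomeomorphUnitInterval.symm
  continuous_toFun := stdSimplexHomeomorphUnitInterval.symm.continuous
  source' := by rw [Homeomorph.symm_apply_eq]; rfl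
  target' := by rw [Homeomorph.symm_apply_eq]; rfl

/-- The path in `|S|` given by a `1`-simplex `e`, from `x = ∂₁ e` to `y = ∂₀ e`. -/
def edgePath (e : S _⦋1⦌) {x y : S _⦋0⦌} (hx : S.δ 1 e = x) (hy : S.δ 0 e = y) :
    Path (pt x) (pt y) :=
  (unitPath.map (chi e).continuous).cast
    (by rw [chi_vertex, ← hx, ← SimplexCategory.δ_one_eq_const]; rfl)
    (by rw [chi_vertex, ← hy, ← SimplexCategory.δ_zero_eq_const]; rfl)

end Realization

/-! ### The fundamental groupoid `ΠX = Π S|X|` -/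

namespace GSSet
variable (X : GSSet G)

/-- The action of `g` on `|X|`. -/
def topAct (g : G) : C(|X.V|, |X.V|) := (SSet.toTop.map (show X.V ⟶ X.V from X.ρ g)).hom

lemma topAct_one (x : |X.V|) : X.topAct 1 x = x := by
  unfold topAct
  rw [show (show X.V ⟶ X.V from X.ρ 1) = 𝟙 X.V from X.ρ.map_one, CategoryTheory.Functor.map_id]
  rfl

lemma topAct_mul (g h : G) (x : |X.V|) : X.topAct (g * h) x = X.topAct g (X.topAct h x) := by
  unfold topAct
  rw [show (show X.V ⟶ X.V from X.ρ (g * h)) =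
    (show X.V ⟶ X.V from X.ρ h) ≫ (show X.V ⟶ X.V from X.ρ g) from X.ρ.map_mul g h,
    CategoryTheory.Functor.map_comp]
  rfl

lemma topAct_chi (g : G) {n : ℕ} (s : X.V _⦋n⦌) (z : stdSimplex ℝ (Fin (n + 1))) :
    X.topAct g (chi s z) = chi (X.act g s) z := map_chi _ s z

/-- The space of `G`-maps `G ⧸ H → |X|` (homeomorphic to `|X|^H` by evaluation at `eH`). By the
adjunction between `|·|` and `S`, its points are the equivariant `0`-simplices
`G ⧸ H × Δ[0] → S|X|` of type `H`, its paths are the equivariant `1`-simplices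
`G ⧸ H × Δ[1] → S|X|`, and homotopies of paths relative to the end points
are the `G`-homotopies `G ⧸ H × Δ[1] × Δ[1] → S|X|` relative to `G ⧸ H × ∂Δ[1]`. -/
abbrev OrbitMap (U : Orb G) : Type u :=
  {x : U.coset → |X.V| // ∀ (g : G) (a : U.coset), x (g • a) = X.topAct g (x a)}


variable {X} in
lemma OrbitMap.ext {U : Orb G} {x y : X.OrbitMap U} (h : ∀ a, x.1 a = y.1 a) : x = y :=
  Subtype.ext (funext h)

variable {X} in
lemma OrbitMap.ext_base {U : Orb G} {x y : X.OrbitMap U} (h : x.1 U.base = y.1 U.base) : x = y := by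
  refine OrbitMap.ext fun a => ?_
  obtain ⟨g, rfl⟩ := QuotientGroup.mk_surjective a
  rw [Orb.mk_eq_smul, x.2, y.2, h]

/-- Precomposition with a `G`-map `f : G ⧸ H → G ⧸ K`. -/
def precomp {U V : Orb G} (f : U ⟶ V) : C(X.OrbitMap V, X.OrbitMap U) where
  toFun x := ⟨fun a => x.1 (Orb.fn f a), fun g a =>
    (congrArg x.1 (Orb.fn_smul f g a)).trans (x.2 g _)⟩
  continuous_toFun := by
    refine Continuous.subtype_mk (continuous_pi fun a => ?_) _
    exact (continuous_apply (Orb.fn f a)).comp continuous_subtype_val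

/-- Objects of the fundamental groupoid `ΠX`: equivariant `0`-simplices of `S|X|`. -/
@[ext]
structure FundGpd where
  /-- the orbit `G ⧸ H`, that is, the type of the simplex -/
  orb : Orb G
  /-- the equivariant `0`-simplex of `S|X|` -/
  point : X.OrbitMap orb

variable {X} in
/-- A morphism `x_H → y_K` in `ΠX`: a class `[f, φ]`, where `f : G ⧸ H → G ⧸ K` is a `G`-map and
`φ` is the homotopy class, relative to the end points, of an equivariant `1`-simplex of type `H`
of `S|X|` from `x_H` to `y_K ∘ (f × id)`. -/
@[ext]
structure FundGpd.Hom (x y : X.FundGpd) where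
  /-- the map of orbits -/
  base : x.orb ⟶ y.orb
  /-- the homotopy class of paths -/
  path : Path.Homotopic.Quotient x.point (X.precomp base y.point)

/-- `ΠX` is a category: `[f₂, φ₂] ∘ [f₁, φ₁] = [f₂ ∘ f₁, ψ]`, with `ψ` the concatenation of `φ₁`
and `φ₂ ∘ (f₁ × id)`. -/
instance : Category X.FundGpd where
  Hom x y := FundGpd.Hom x y
  id x := ⟨𝟙 x.orb, Path.Homotopic.Quotient.refl x.point⟩
  comp p q := ⟨p.base ≫ q.base, Path.Homotopic.Quotient.trans p.path (q.path.map (X.precomp p.base))⟩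
  id_comp := by
    rintro x y ⟨f, p⟩
    induction p using Path.Homotopic.Quotient.ind with | mk p =>
    exact congrArg (fun q => FundGpd.Hom.mk (x := x) (y := y) f q)
      (Path.Homotopic.Quotient.refl_trans (Path.Homotopic.Quotient.mk p))
  comp_id := by
    rintro x y ⟨f, p⟩
    exact congrArg (fun q => FundGpd.Hom.mk (x := x) (y := y) f q)
      (Path.Homotopic.Quotient.trans_refl p)
  assoc := by
    rintro x y z w ⟨f, p⟩ ⟨g, q⟩ ⟨h, r⟩
    induction q using Path.Homotopic.Quotient.ind with | mk q =>
    induction r using Path.Homotopic.Quotient.ind with | mk r =>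
    refine congrArg (fun q => FundGpd.Hom.mk (x := x) (y := w) (f ≫ g ≫ h) q)
      ((Path.Homotopic.Quotient.trans_assoc p ((Path.Homotopic.Quotient.mk q).map (X.precomp f))
        ((Path.Homotopic.Quotient.mk r).map (X.precomp (f ≫ g)))).trans ?_)
    refine congrArg (Path.Homotopic.Quotient.trans p) ?_
    exact congrArg Path.Homotopic.Quotient.mk
      (Path.map_trans q (r.map (X.precomp g).continuous) (X.precomp f).continuous).symm

variable {X}

/-- The morphism `[f, φ]` given by a path `φ`. -/
def FundGpd.homMk {x y : X.FundGpd} (f : x.orb ⟶ y.orb)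
    (p : Path.Homotopic.Quotient x.point (X.precomp f y.point)) : x ⟶ y :=
  show FundGpd.Hom x y from ⟨f, p⟩

/-- The morphism `[f, k]` with `k` the constant path, defined when `x_H = y_K ∘ (f × id)`. -/
def FundGpd.homConst {x y : X.FundGpd} (f : x.orb ⟶ y.orb)
    (h : x.point = X.precomp f y.point) : x ⟶ y :=
  FundGpd.homMk f ((Path.Homotopic.Quotient.refl x.point).cast rfl h.symm)

lemma FundGpd.homConst_comp {x y z : X.FundGpd} (f : x.orb ⟶ y.orb)
    (h : x.point = X.precomp f y.point) (g : y.orb ⟶ z.orb)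
    (q : Path.Homotopic.Quotient y.point (X.precomp g z.point)) :
    FundGpd.homConst f h ≫ FundGpd.homMk g q =
      FundGpd.homMk (f ≫ g) ((q.map (X.precomp f)).cast h rfl) := by
  obtain ⟨U, x⟩ := x
  change U ⟶ y.orb at f
  change x = X.precomp (U := U) f y.point at h
  subst h
  induction q using Path.Homotopic.Quotient.ind with | mk q =>
  exact congrArg (fun r => FundGpd.homMk (x := ⟨U, X.precomp f y.point⟩) (y := z) (f ≫ g) r)
    (Path.Homotopic.Quotient.refl_trans (Path.Homotopic.Quotient.mk (q.map (X.precomp f).continuous)))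

lemma FundGpd.comp_homConst {x y z : X.FundGpd} (f : x.orb ⟶ y.orb)
    (p : Path.Homotopic.Quotient x.point (X.precomp f y.point))
    (g : y.orb ⟶ z.orb) (h : y.point = X.precomp g z.point) :
    FundGpd.homMk f p ≫ FundGpd.homConst g h =
      FundGpd.homMk (f ≫ g) (p.cast rfl (congrArg (X.precomp f) h.symm)) := by
  obtain ⟨V, y⟩ := y
  change V ⟶ z.orb at g
  change y = X.precomp (U := V) g z.point at h
  subst h
  induction p using Path.Homotopic.Quotient.ind with | mk p =>
  exact congrArg (fun r => FundGpd.homMk (x := x) (y := z) (f ≫ g) r)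
    (Path.Homotopic.Quotient.trans_refl (Path.Homotopic.Quotient.mk p))

end GSSet

/-- An equivariant local coefficient system on `X`: a contravariant functor `ΠX → Ab`. -/
abbrev LocalCoeff (X : GSSet G) := X.FundGpdᵒᵖ ⥤ AddCommGrpCat.{u}

/-! ### Alternating sums -/

lemma altSum_sq {A : Type*} [AddCommGroup A] (n : ℕ) (t : Fin (n + 3) → Fin (n + 2) → A)
    (h : ∀ i j : Fin (n + 2), i ≤ j → t j.succ i = t i.castSucc j) :
    ∑ j : Fin (n + 3), (-1 : ℤ) ^ (j : ℕ) • ∑ i : Fin (n + 2), (-1 : ℤ) ^ (i : ℕ) • t j i = 0 := by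
  simp only [Finset.smul_sum]
  rw [Finset.sum_comm, ← Finset.sum_product']
  let P := Fin (n + 2) × Fin (n + 3)
  let S : Finset P := Finset.univ.filter fun ij => (ij.2 : ℕ) ≤ (ij.1 : ℕ)
  rw [Finset.univ_product_univ, ← Finset.sum_add_sum_compl S, ← eq_neg_iff_add_eq_zero,
    ← Finset.sum_neg_distrib]
  let φ : ∀ ij : P, ij ∈ S → P := fun ij hij =>
    (Fin.castLT ij.2 (lt_of_le_of_lt (Finset.mem_filter.mp hij).right (Fin.is_lt ij.1)), ij.1.succ)
  apply Finset.sum_bij φ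
  · intro ij hij
    simp_rw [S, φ, Finset.compl_filter, Finset.mem_filter_univ, Fin.val_succ,
      Fin.val_castLT] at hij ⊢
    lia
  · rintro ⟨i, j⟩ hij ⟨i', j'⟩ hij' h
    rw [Prod.mk_inj]
    exact ⟨by simpa [φ] using! congr_arg Prod.snd h,
      by simpa [φ, Fin.castSucc_castLT] using! congr_arg Fin.castSucc (congr_arg Prod.fst h)⟩
  · rintro ⟨i', j'⟩ hij'
    simp_rw [S, Finset.compl_filter, Finset.mem_filter_univ, not_le] at hij'
    refine ⟨(j'.pred <| ?_, Fin.castSucc i'), ?_, ?_⟩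
    · rintro rfl
      simp only [Fin.val_zero, not_lt_zero] at hij'
    · simpa [S] using! Nat.le_sub_one_of_lt hij'
    · simp only [φ, Fin.castLT_castSucc, Fin.succ_pred]
  · rintro ⟨i, j⟩ hij
    have hij' : (j : ℕ) ≤ (i : ℕ) := (Finset.mem_filter.mp hij).right
    have hj : j = (Fin.castLT j (lt_of_le_of_lt hij' i.is_lt)).castSucc := by simp
    simp only [φ, smul_smul, ← neg_smul]
    rw [h (Fin.castLT j (lt_of_le_of_lt hij' i.is_lt)) i (by simpa [Fin.le_def] using hij'), ← hj]
    congr 1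
    simp only [Fin.val_succ, Fin.val_castLT, pow_add, pow_one, mul_neg, neg_neg, mul_one, neg_mul]
    exact mul_comm _ _

lemma altSum_degen {A : Type*} [AddCommGroup A] {n : ℕ} (a : Fin (n + 2) → A) (i : Fin (n + 1))
    (h : ∀ j, j ≠ i.castSucc → j ≠ i.succ → a j = 0) (he : a i.castSucc = a i.succ) :
    ∑ j : Fin (n + 2), (-1 : ℤ) ^ (j : ℕ) • a j = 0 := by
  have hne : i.castSucc ≠ i.succ := (Fin.castSucc_lt_succ).ne
  rw [← Finset.sum_subset (Finset.subset_univ {i.castSucc, i.succ}), Finset.sum_pair hne, he,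
    ← add_smul]
  · simp [pow_succ]
  · intro j _ hj
    simp only [Finset.mem_insert, Finset.mem_singleton, not_or] at hj
    rw [h j hj.1 hj.2, smul_zero]

instance (n : ℕ) : SimplyConnectedSpace (stdSimplex ℝ (Fin (n + 1))) :=
  haveI : ContractibleSpace (stdSimplex ℝ (Fin (n + 1))) :=
    (convex_stdSimplex ℝ (Fin (n + 1))).contractibleSpace ⟨_, single_mem_stdSimplex ℝ 0⟩
  SimplyConnectedSpace.ofContractible _

/-! ### Equivariant simplices as objects and morphisms of `ΠX` -/

namespace ESimplex
open GSSet
variable {X : GSSet G} {U V W : Orb G} {l m n : ℕ}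

/-- The map `Δⁿ → Map_G(G ⧸ H, |X|)` adjoint to the composite of `σ` with the unit `X → S|X|`. -/
def realize (σ : ESimplex X U n) : C(stdSimplex ℝ (Fin (n + 1)), X.OrbitMap U) where
  toFun z := ⟨fun a => chi (σ.val a) z, fun g a =>
    (congrArg (fun s : X.V _⦋n⦌ => chi s z) (σ.val_smul g a)).trans (X.topAct_chi g _ _).symm⟩
  continuous_toFun := by
    refine Continuous.subtype_mk (continuous_pi fun a => ?_) _
    exact (chi (σ.val a)).continuous

lemma realize_face (σ : ESimplex X U n) (θ : ⦋m⦌ ⟶ ⦋n⦌) (z : stdSimplex ℝ (Fin (m + 1))) :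
    (σ.face θ).realize z = σ.realize (stdSimplex.map θ z) :=
  OrbitMap.ext fun a => (congrArg (fun s : X.V _⦋m⦌ => chi s z) (σ.val_face θ a)).trans
    (chi_map θ (σ.val a) z)

lemma realize_along (σ : ESimplex X V n) (f : U ⟶ V) (z : stdSimplex ℝ (Fin (n + 1))) :
    (σ.along f).realize z = X.precomp f (σ.realize z) :=
  OrbitMap.ext fun a => congrArg (fun s : X.V _⦋n⦌ => chi s z) (σ.val_along f a)

/-- An equivariant `0`-simplex of `X`, viewed as an object of `ΠX` by means of the unit
`X → S|X|`. -/
def obj (x : ESimplex X U 0) : X.FundGpd where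
  orb := U
  point := x.realize (stdSimplex.vertex (0 : Fin 1))

lemma realize_vertex (σ : ESimplex X U n) (i : Fin (n + 1)) :
    σ.realize (stdSimplex.vertex i) = (σ.face (SimplexCategory.const ⦋0⦌ ⦋n⦌ i)).obj.point := by
  refine Eq.trans ?_ (σ.realize_face _ _).symm
  rw [stdSimplex.map_vertex]
  rfl

/-- For a path in `Δⁿ` between two vertices, the induced morphism of `ΠX`. -/
def pathHom (σ : ESimplex X U n) {i j : Fin (n + 1)}
    (p : Path (stdSimplex.vertex i : stdSimplex ℝ (Fin (n + 1))) (stdSimplex.vertex j))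
    {x y : ESimplex X U 0}
    (hx : σ.face (SimplexCategory.const ⦋0⦌ ⦋n⦌ i) = x)
    (hy : σ.face (SimplexCategory.const ⦋0⦌ ⦋n⦌ j) = y) : x.obj ⟶ y.obj :=
  FundGpd.homMk (x := x.obj) (y := y.obj) (𝟙 U) (Path.Homotopic.Quotient.mk
    ((p.map σ.realize.continuous).cast (by rw [realize_vertex, hx])
      ((by rw [realize_vertex, hy] : y.obj.point = σ.realize (stdSimplex.vertex j)))))

/-- The morphism `[id, α]` of `ΠX` given by an equivariant `1`-simplex `α` of `X`, from
`x = α ∘ (id × δ₁)` to `y = α ∘ (id × δ₀)`. -/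
def edgeHom (α : ESimplex X U 1) {x y : ESimplex X U 0} (hx : α.face (SimplexCategory.δ 1) = x)
    (hy : α.face (SimplexCategory.δ 0) = y) : x.obj ⟶ y.obj :=
  α.pathHom unitPath (by rw [← hx, SimplexCategory.δ_one_eq_const])
    (by rw [← hy, SimplexCategory.δ_zero_eq_const])

lemma pathHom_congr (σ : ESimplex X U n) {i j : Fin (n + 1)}
    (p q : Path (stdSimplex.vertex i : stdSimplex ℝ (Fin (n + 1))) (stdSimplex.vertex j))
    {x y : ESimplex X U 0}
    (hx : σ.face (SimplexCategory.const ⦋0⦌ ⦋n⦌ i) = x)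
    (hy : σ.face (SimplexCategory.const ⦋0⦌ ⦋n⦌ j) = y) :
    σ.pathHom p hx hy = σ.pathHom q hx hy := by
  refine congrArg (FundGpd.homMk (x := x.obj) (y := y.obj) (𝟙 U)) ?_
  refine Path.Homotopic.Quotient.eq.2 ?_
  exact ((SimplyConnectedSpace.paths_homotopic p q).map σ.realize).pathCast _ _

/-- The morphism of `ΠX` given by the edge from the vertex `i` to the vertex `j` of `σ`. -/
def vHom (σ : ESimplex X U n) (i j : Fin (n + 1)) {x y : ESimplex X U 0}
    (hx : σ.face (SimplexCategory.const ⦋0⦌ ⦋n⦌ i) = x)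
    (hy : σ.face (SimplexCategory.const ⦋0⦌ ⦋n⦌ j) = y) : x.obj ⟶ y.obj :=
  σ.pathHom (PathConnectedSpace.somePath (stdSimplex.vertex i) (stdSimplex.vertex j)) hx hy

lemma vHom_comp (σ : ESimplex X U n) (i j k : Fin (n + 1)) {x y z : ESimplex X U 0}
    (hx : σ.face (SimplexCategory.const ⦋0⦌ ⦋n⦌ i) = x)
    (hy : σ.face (SimplexCategory.const ⦋0⦌ ⦋n⦌ j) = y)
    (hz : σ.face (SimplexCategory.const ⦋0⦌ ⦋n⦌ k) = z) :
    σ.vHom i j hx hy ≫ σ.vHom j k hy hz = σ.vHom i k hx hz := by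
  let p := PathConnectedSpace.somePath (stdSimplex.vertex i : stdSimplex ℝ (Fin (n + 1))) (stdSimplex.vertex j)
  let q := PathConnectedSpace.somePath (stdSimplex.vertex j : stdSimplex ℝ (Fin (n + 1))) (stdSimplex.vertex k)
  refine Eq.trans ?_ (σ.pathHom_congr (p.trans q) _ hx hz)
  refine congrArg (FundGpd.homMk (x := x.obj) (y := z.obj) (𝟙 U)) ?_
  refine congrArg Path.Homotopic.Quotient.mk ?_
  refine Path.ext (funext fun t => ?_)
  refine Eq.trans (Path.trans_apply _ _ t) ?_
  refine Eq.trans ?_ (congrArg σ.realize (Path.trans_apply p q t)).symm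
  split_ifs <;> rfl

lemma vHom_self (σ : ESimplex X U n) (i : Fin (n + 1)) {x : ESimplex X U 0}
    (hx : σ.face (SimplexCategory.const ⦋0⦌ ⦋n⦌ i) = x) :
    σ.vHom i i hx hx = 𝟙 x.obj := by
  refine (σ.pathHom_congr _ (Path.refl _) hx hx).trans ?_
  refine congrArg (FundGpd.homMk (x := x.obj) (y := x.obj) (𝟙 U)) ?_
  refine congrArg Path.Homotopic.Quotient.mk ?_
  subst hx
  exact Path.ext (funext fun t => σ.realize_vertex i)

lemma eqToHom_eq_vHom (σ : ESimplex X U n) (i : Fin (n + 1)) {x y : ESimplex X U 0}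
    (hx : σ.face (SimplexCategory.const ⦋0⦌ ⦋n⦌ i) = x)
    (hy : σ.face (SimplexCategory.const ⦋0⦌ ⦋n⦌ i) = y) :
    eqToHom (congrArg obj (hx.symm.trans hy)) = σ.vHom i i hx hy := by
  subst hx
  subst hy
  exact (σ.vHom_self i rfl).symm

lemma face_const (σ : ESimplex X U n) (θ : ⦋m⦌ ⟶ ⦋n⦌) (i : Fin (m + 1)) :
    (σ.face θ).face (SimplexCategory.const ⦋0⦌ ⦋m⦌ i) =
      σ.face (SimplexCategory.const ⦋0⦌ ⦋n⦌ (θ i)) := by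
  rw [face_face, SimplexCategory.const_comp]
  rfl

lemma vHom_face (σ : ESimplex X U n) (θ : ⦋m⦌ ⟶ ⦋n⦌) (i j : Fin (m + 1)) {x y : ESimplex X U 0}
    (hx : (σ.face θ).face (SimplexCategory.const ⦋0⦌ ⦋m⦌ i) = x)
    (hy : (σ.face θ).face (SimplexCategory.const ⦋0⦌ ⦋m⦌ j) = y) :
    (σ.face θ).vHom i j hx hy =
      σ.vHom (θ i) (θ j) ((σ.face_const θ i).symm.trans hx) ((σ.face_const θ j).symm.trans hy) := by
  let p := PathConnectedSpace.somePath (stdSimplex.vertex i : stdSimplex ℝ (Fin (m + 1))) (stdSimplex.vertex j)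
  refine Eq.trans ?_ (σ.pathHom_congr ((p.map (stdSimplex.continuous_map θ)).cast
    (stdSimplex.map_vertex _ _).symm (stdSimplex.map_vertex _ _).symm) _ _ _)
  refine congrArg (FundGpd.homMk (x := x.obj) (y := y.obj) (𝟙 U)) ?_
  refine congrArg Path.Homotopic.Quotient.mk ?_
  exact Path.ext (funext fun t => σ.realize_face θ (p t))

lemma edgeHom_eq (α : ESimplex X U 1) {x y : ESimplex X U 0}
    (hx : α.face (SimplexCategory.δ 1) = x) (hy : α.face (SimplexCategory.δ 0) = y) :
    α.edgeHom hx hy = α.vHom 0 1 (by rw [← hx, SimplexCategory.δ_one_eq_const])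
      (by rw [← hy, SimplexCategory.δ_zero_eq_const]) := by
  exact α.pathHom_congr _ _ _ _

lemma point_along (x : ESimplex X V 0) (f : U ⟶ V) :
    (x.along f).obj.point = X.precomp f x.obj.point :=
  x.realize_along f _

/-- For compatible equivariant `0`-simplices `x = y ∘ (f × id)`, the morphism `[f, k] : x → y` of
`ΠX` with `k` the constant path. -/
def alongHom {x : ESimplex X U 0} {y : ESimplex X V 0} (f : U ⟶ V) (h : y.along f = x) :
    x.obj ⟶ y.obj :=
  FundGpd.homConst (x := x.obj) (y := y.obj) f (by rw [← h]; exact y.point_along f)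

lemma alongHom_vHom (σ : ESimplex X V n) (f : U ⟶ V) (i j : Fin (n + 1)) {x y : ESimplex X U 0}
    {x' y' : ESimplex X V 0}
    (hx : (σ.along f).face (SimplexCategory.const ⦋0⦌ ⦋n⦌ i) = x)
    (hy : (σ.along f).face (SimplexCategory.const ⦋0⦌ ⦋n⦌ j) = y)
    (hx' : σ.face (SimplexCategory.const ⦋0⦌ ⦋n⦌ i) = x')
    (hy' : σ.face (SimplexCategory.const ⦋0⦌ ⦋n⦌ j) = y')
    (h : x'.along f = x) (h' : y'.along f = y) :
    alongHom f h ≫ σ.vHom i j hx' hy' = (σ.along f).vHom i j hx hy ≫ alongHom f h' := by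
  subst h h' hx' hy'
  let p := PathConnectedSpace.somePath (stdSimplex.vertex i : stdSimplex ℝ (Fin (n + 1)))
    (stdSimplex.vertex j)
  refine (FundGpd.homConst_comp (y := ESimplex.obj _) (z := ESimplex.obj _) _ _ _ _).trans
    (Eq.trans ?_ (FundGpd.comp_homConst (x := ESimplex.obj _) (y := ESimplex.obj _)
      (z := ESimplex.obj _) _ _ _ _).symm)
  refine congrArg (FundGpd.homMk (x := ESimplex.obj _) (y := ESimplex.obj _) f) ?_
  refine congrArg Path.Homotopic.Quotient.mk ?_
  exact Path.ext (funext fun t => (σ.realize_along f _).symm)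

end ESimplex

/-! ### Simplicial Bredon–Illman cohomology with local coefficients -/

namespace ESimplex
variable {X : GSSet G} {U V W : Orb G} {l m n : ℕ}

/-- `σ_H = σ ∘ (id × δ_{(1,2,…,n)})`; the composite `δ_{(1,2,…,n)} : Δ[0] → Δ[n]` is the inclusion
of the vertex `0`. -/
abbrev init (σ : ESimplex X U n) : ESimplex X U 0 := σ.face (SimplexCategory.const ⦋0⦌ ⦋n⦌ 0)

/-- The face `σ^{(j)} = σ ∘ (id × δ_j)`. -/
abbrev del (σ : ESimplex X U (n + 1)) (j : Fin (n + 2)) : ESimplex X U n :=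
  σ.face (SimplexCategory.δ j)

lemma init_del_succ (σ : ESimplex X U (n + 1)) (j : Fin (n + 1)) :
    (σ.del j.succ).init = σ.init :=
  σ.face_const _ _

lemma init_along (σ : ESimplex X V n) (f : U ⟶ V) : σ.init.along f = (σ.along f).init :=
  (σ.along_face f _).symm

/-- The edge `δ_{(2,…,n+1)} : Δ[1] → Δ[n+1]` from the vertex `0` to the vertex `1`. -/
def edge01 (n : ℕ) : ⦋1⦌ ⟶ ⦋n + 1⦌ := SimplexCategory.mkOfLe 0 1 (Fin.zero_le 1)

/-- The morphism `σ_* = [id, α] : σ_H → σ^{(0)}_H` of `ΠX`, with `α = σ ∘ (id × δ_{(2,…,n+1)})`. -/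
def star (σ : ESimplex X U (n + 1)) : σ.init.obj ⟶ (σ.del 0).init.obj :=
  edgeHom (σ.face (edge01 n))
    (by rw [face_face, SimplexCategory.δ_one_eq_const, SimplexCategory.const_comp]; rfl)
    (by
      unfold init del
      rw [face_face, face_face, SimplexCategory.δ_zero_eq_const, SimplexCategory.const_comp,
        SimplexCategory.const_comp]
      rfl)

/-- The morphism `g_* = [f, k] : (σ ∘ (f × id))_H → σ_K` of `ΠX`, with `k` constant. -/
def compat (σ : ESimplex X V n) (f : U ⟶ V) : (σ.along f).init.obj ⟶ σ.init.obj :=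
  alongHom f (σ.init_along f)

lemma eqToHom_alongHom {x x' : ESimplex X U 0} {y : ESimplex X V 0} (f : U ⟶ V)
    (h : y.along f = x) (e : x' = x) :
    eqToHom (congrArg obj e) ≫ alongHom f h = alongHom f (h.trans e.symm) := by
  subst e
  rw [eqToHom_refl, Category.id_comp]

lemma vHom_eqToHom (σ : ESimplex X U n) (i j : Fin (n + 1)) {x y z : ESimplex X U 0}
    (hx : σ.face (SimplexCategory.const ⦋0⦌ ⦋n⦌ i) = x)
    (hy : σ.face (SimplexCategory.const ⦋0⦌ ⦋n⦌ j) = y) (e : y = z) :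
    σ.vHom i j hx hy ≫ eqToHom (congrArg obj e) = σ.vHom i j hx (hy.trans e) := by
  subst e
  rw [eqToHom_refl, Category.comp_id]

lemma simplex_injective : Function.Injective (simplex (X := X) (U := U) (n := n)) := by
  intro σ τ h
  have hb : σ.val U.base = τ.val U.base := congrArg Subtype.val h
  have hv : ∀ a, σ.val a = τ.val a := fun a => by
    obtain ⟨g, rfl⟩ := QuotientGroup.mk_surjective a
    rw [Orb.mk_eq_smul, val_smul, val_smul, hb]
  apply Action.Hom.ext
  refine SSet.hom_ext fun k => ?_
  have key : ∀ (ρ : ESimplex X U n) (p : U.coset × (SSet.stdSimplex.{u}.obj ⦋n⦌).obj k),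
      ρ.hom.app k p = X.V.map (SSet.stdSimplex.objEquiv p.2).op (ρ.val p.1) := by
    intro ρ p
    refine Eq.trans ?_ (NatTrans.naturality_apply ρ.hom (SSet.stdSimplex.objEquiv p.2).op
      (top U n p.1))
    refine congrArg (ρ.hom.app k) ?_
    refine Prod.ext rfl ?_
    have h := SSet.stdSimplex.map_objEquiv_symm (𝟙 ⦋n⦌) (SSet.stdSimplex.objEquiv p.2).op
    refine Eq.trans ?_ h.symm
    rw [Category.comp_id]
    exact (SSet.stdSimplex.objEquiv.symm_apply_apply p.2).symm
  ext p
  exact (key σ p).trans ((congrArg _ (hv p.1)).trans (key τ p).symm)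

/-- `σ` is degenerate when the simplex `σ'` of `X^H` is. -/
def Degenerate (σ : ESimplex X U n) : Prop :=
  σ.simplex ∈ SSet.degenerate (X.fixed U.sub : SSet.{u}) n

end ESimplex

/-- The homomorphism `M(p) : M(y) → M(x)` of a morphism `p : x → y` of `ΠX`. -/
def LocalCoeff.res {X : GSSet G} (M : LocalCoeff X) {x y : X.FundGpd} (p : x ⟶ y) :
    M.obj (op y) →+ M.obj (op x) := (M.map p.op).hom

lemma LocalCoeff.res_id {X : GSSet G} (M : LocalCoeff X) {x : X.FundGpd} (m : M.obj (op x)) :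
    M.res (𝟙 x) m = m := by
  unfold LocalCoeff.res
  rw [op_id, M.map_id]
  rfl

lemma LocalCoeff.res_res {X : GSSet G} (M : LocalCoeff X) {x y z : X.FundGpd} (p : x ⟶ y)
    (q : y ⟶ z) (m : M.obj (op z)) : M.res p (M.res q m) = M.res (p ≫ q) m := by
  unfold LocalCoeff.res
  rw [op_comp, M.map_comp]
  rfl

section Cochains
variable (X : GSSet G) (M : LocalCoeff X)

/-- Functions `f` on the equivariant `n`-simplices of `X` with `f σ ∈ M (σ_H)`. -/
abbrev Coch (n : ℕ) : Type u := ∀ (U : Orb G) (σ : ESimplex X U n), M.obj (op σ.init.obj)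

variable {X M}

/-- The coboundary `δ f (σ) = M (σ_*) f (σ^{(0)}) + ∑_{j ≥ 1} (-1)^j f (σ^{(j)})`. For `j ≥ 1`
the group `M (σ^{(j)}_H)` is identified with `M (σ_H)` through the equality `σ^{(j)}_H = σ_H`. -/
def coboundary (n : ℕ) : Coch X M n →+ Coch X M (n + 1) where
  toFun f U σ := M.res σ.star (f U (σ.del 0)) +
    ∑ j : Fin (n + 1), (-1 : ℤ) ^ ((j : ℕ) + 1) •
      M.res (eqToHom (congrArg ESimplex.obj (σ.init_del_succ j).symm)) (f U (σ.del j.succ))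
  map_zero' := by
    funext U σ
    simp
  map_add' f g := by
    funext U σ
    simp [smul_add, Finset.sum_add_distrib]
    abel

/-- The operator `f ↦ (σ ↦ M (σ_H → (σ ∘ (id × θ))_H) f (σ ∘ (id × θ)))`. -/
def pull {m n : ℕ} (θ : ⦋m⦌ ⟶ ⦋n⦌) (f : Coch X M m) : Coch X M n := fun U σ =>
  M.res (σ.vHom 0 (θ 0) rfl (σ.face_const θ 0).symm) (f U (σ.face θ))

lemma map_congr_face {U : Orb G} {n : ℕ} (f : Coch X M n) {x : X.FundGpd}
    {σ τ : ESimplex X U n} (h : σ = τ) (p : x ⟶ σ.init.obj) (q : x ⟶ τ.init.obj)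
    (hpq : p ≫ eqToHom (congrArg (fun ρ => ρ.init.obj) h) = q) :
    M.res p (f U σ) = M.res q (f U τ) := by
  subst h
  rw [← hpq, eqToHom_refl, Category.comp_id]

lemma pull_pull {l m n : ℕ} (θ : ⦋m⦌ ⟶ ⦋n⦌) (θ' : ⦋l⦌ ⟶ ⦋m⦌) (f : Coch X M l) :
    pull θ (pull θ' f) = pull (θ' ≫ θ) f := by
  funext U σ
  unfold pull
  rw [LocalCoeff.res_res]
  apply map_congr_face f (σ.face_face θ θ')
  rw [ESimplex.vHom_face, ESimplex.vHom_comp]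
  refine (congrArg _ (ESimplex.eqToHom_eq_vHom σ ((θ' ≫ θ) 0) (x := ((σ.face θ).face θ').init)
    (y := (σ.face (θ' ≫ θ)).init) ?_ ?_)).trans (ESimplex.vHom_comp _ _ _ _ _ _ _)
  · rw [← ESimplex.face_const, ← ESimplex.face_face]
  · rw [← ESimplex.face_const]

lemma coboundary_apply {n : ℕ} (f : Coch X M n) {U : Orb G} (σ : ESimplex X U (n + 1)) :
    coboundary n f U σ = ∑ j : Fin (n + 2), (-1 : ℤ) ^ (j : ℕ) • pull (SimplexCategory.δ j) f U σ := by
  rw [Fin.sum_univ_succ]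
  change M.res _ _ + ∑ _, _ = _
  congr 1
  · simp only [Fin.val_zero, pow_zero, one_smul]
    unfold pull ESimplex.star
    rw [ESimplex.edgeHom_eq, ESimplex.vHom_face]
    rfl
  · refine Finset.sum_congr rfl fun j _ => ?_
    rw [Fin.val_succ]
    congr 1
    unfold pull
    rw [ESimplex.eqToHom_eq_vHom σ 0 rfl (σ.face_const (SimplexCategory.δ j.succ) 0).symm]
    rfl

lemma coboundary_sq {n : ℕ} (f : Coch X M n) : coboundary (n + 1) (coboundary n f) = 0 := by
  funext U σ
  rw [coboundary_apply]
  have h : ∀ j : Fin (n + 3), pull (SimplexCategory.δ j) (coboundary n f) U σ =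
      ∑ i : Fin (n + 2), (-1 : ℤ) ^ (i : ℕ) •
        pull (SimplexCategory.δ j) (pull (SimplexCategory.δ i) f) U σ := by
    intro j
    unfold pull
    rw [coboundary_apply, map_sum]
    refine Finset.sum_congr rfl fun i _ => ?_
    rw [map_zsmul]
    rfl
  simp only [h, pull_pull]
  refine altSum_sq n _ fun i j hij => ?_
  rw [SimplexCategory.δ_comp_δ hij]

variable (X M)

/-- The group `S_G^n(X; M)`: the functions `f` with `f σ = 0` for `σ` degenerate, and with
`f η = M (g_*) f τ` whenever `η = τ ∘ (f × id)`, for a `G`-map `f` of orbits. -/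
def BI (n : ℕ) : AddSubgroup (Coch X M n) where
  carrier := {f | (∀ (U : Orb G) (σ : ESimplex X U n), σ.Degenerate → f U σ = 0) ∧
    ∀ (U V : Orb G) (φ : U ⟶ V) (τ : ESimplex X V n),
      f U (τ.along φ) = M.res (τ.compat φ) (f V τ)}
  zero_mem' := ⟨fun _ _ _ => rfl, fun _ _ _ _ => (map_zero _).symm⟩
  add_mem' {f g} hf hg := ⟨fun U σ h => by
      change f U σ + g U σ = 0
      rw [hf.1 U σ h, hg.1 U σ h, add_zero], fun U V φ τ => by
      change f U _ + g U _ = M.res _ (f V τ + g V τ)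
      rw [hf.2, hg.2, map_add]⟩
  neg_mem' {f} hf := ⟨fun U σ h => by
      change - f U σ = 0
      rw [hf.1 U σ h, neg_zero], fun U V φ τ => by
      change - f U _ = M.res _ (- f V τ)
      rw [hf.2, map_neg]⟩

variable {X M}

lemma pull_along {m n : ℕ} (θ : ⦋m⦌ ⟶ ⦋n⦌) (f : Coch X M m) (hf : f ∈ BI X M m)
    {U V : Orb G} (φ : U ⟶ V) (τ : ESimplex X V n) :
    pull θ f U (τ.along φ) = M.res (τ.compat φ) (pull θ f V τ) := by
  unfold pull
  rw [LocalCoeff.res_res]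
  have h1 := hf.2 U V φ (τ.face θ)
  have h2 : (τ.along φ).face θ = (τ.face θ).along φ := τ.along_face φ θ
  refine (map_congr_face f h2 _ _ rfl).trans ?_
  rw [h1, LocalCoeff.res_res]
  congr 2
  have e := ESimplex.vHom_eqToHom (τ.along φ) 0 (θ 0) rfl ((τ.along φ).face_const θ 0).symm
    (congrArg ESimplex.init h2)
  refine (congrArg (· ≫ (τ.face θ).compat φ) e).trans ?_
  exact (ESimplex.alongHom_vHom τ φ 0 (θ 0) _ _ rfl (τ.face_const θ 0).symm _ _).symm

lemma delta_sigma_degenerate (S : SSet.{u}) {n : ℕ} (i : Fin (n + 1)) (y : S _⦋n⦌)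
    (j : Fin (n + 2)) (h1 : j ≠ i.castSucc) (h2 : j ≠ i.succ) :
    S.δ j (S.σ i y) ∈ S.degenerate n := by
  cases n with
  | zero =>
    exfalso
    simp only [ne_eq, Fin.ext_iff, Fin.val_castSucc, Fin.val_succ] at h1 h2
    omega
  | succ n =>
    simp only [ne_eq, Fin.ext_iff, Fin.val_castSucc, Fin.val_succ] at h1 h2
    rcases Nat.lt_or_ge (j : ℕ) (i : ℕ) with h | h
    · obtain ⟨j, rfl⟩ : ∃ j' : Fin (n + 2), j'.castSucc = j :=
        ⟨⟨j, by omega⟩, rfl⟩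
      obtain ⟨i, rfl⟩ : ∃ i' : Fin (n + 1), i'.succ = i :=
        ⟨⟨i - 1, by omega⟩, Fin.ext (by simp only [Fin.val_succ]; omega)⟩
      rw [SSet.δ_comp_σ_of_le_apply (by
        simp only [Fin.le_def, Fin.val_castSucc, Fin.val_succ] at h ⊢; omega)]
      exact S.σ_mem_degenerate _ _
    · obtain ⟨j, rfl⟩ : ∃ j' : Fin (n + 2), j'.succ = j :=
        ⟨⟨j - 1, by omega⟩, Fin.ext (by simp only [Fin.val_succ]; omega)⟩
      simp only [Fin.val_succ] at h h1 h2
      obtain ⟨i, rfl⟩ : ∃ i' : Fin (n + 1), i'.castSucc = i :=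
        ⟨⟨i, by omega⟩, rfl⟩
      rw [SSet.δ_comp_σ_of_gt_apply (by
        simp only [Fin.lt_def, Fin.val_castSucc] at h h1 h2 ⊢; omega)]
      exact S.σ_mem_degenerate _ _

lemma res_vHom_injective {U : Orb G} {n : ℕ} (τ : ESimplex X U n) (i j : Fin (n + 1))
    {x y : ESimplex X U 0} (hx : τ.face (SimplexCategory.const ⦋0⦌ ⦋n⦌ i) = x)
    (hy : τ.face (SimplexCategory.const ⦋0⦌ ⦋n⦌ j) = y) :
    Function.Injective (M.res (τ.vHom i j hx hy)) := by
  intro a b h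
  have h' := congrArg (M.res (τ.vHom j i hy hx)) h
  rwa [LocalCoeff.res_res, LocalCoeff.res_res, ESimplex.vHom_comp, ESimplex.vHom_self,
    LocalCoeff.res_id, LocalCoeff.res_id] at h'

lemma coboundary_mem {n : ℕ} (f : Coch X M n) (hf : f ∈ BI X M n) :
    coboundary n f ∈ BI X M (n + 1) := by
  refine ⟨fun U σ h => ?_, fun U V φ τ => ?_⟩
  · unfold ESimplex.Degenerate at h
    rw [SSet.degenerate_eq_iUnion_range_σ, Set.mem_iUnion] at h
    obtain ⟨i, y, hy⟩ := h
    have hσ : (σ.del i.castSucc).face (SimplexCategory.σ i) = σ := by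
      apply ESimplex.simplex_injective
      rw [ESimplex.simplex_face, ESimplex.simplex_face, ← hy]
      exact congrArg (SimplicialObject.σ (X.fixed U.sub : SSet.{u}) i) (SSet.δ_comp_σ_self_apply i y)
    rw [coboundary_apply]
    refine altSum_degen _ i (fun j hj hj' => ?_) ?_
    · refine (congrArg (M.res _) (hf.1 U (σ.del j) ?_)).trans (map_zero _)
      unfold ESimplex.Degenerate
      rw [ESimplex.simplex_face, ← hy]
      exact delta_sigma_degenerate _ i y j hj hj'
    · rw [← hσ]
      generalize σ.del i.castSucc = τ
      apply res_vHom_injective τ 0 (SimplexCategory.σ i 0) rfl (τ.face_const _ 0).symm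
      change pull (SimplexCategory.σ i) (pull _ f) U τ = pull (SimplexCategory.σ i) (pull _ f) U τ
      rw [pull_pull, pull_pull, SimplexCategory.δ_comp_σ_self, SimplexCategory.δ_comp_σ_succ]
  · rw [coboundary_apply, coboundary_apply, map_sum]
    refine Finset.sum_congr rfl fun i _ => ?_
    rw [map_zsmul, pull_along _ f hf]

variable (X M)

/-- The cochain complex `S_G(X; M)`. -/
def BIComplex : CochainComplex AddCommGrpCat.{u} ℕ :=
  CochainComplex.of (fun n => AddCommGrpCat.of (BI X M n))
    (fun n => AddCommGrpCat.ofHom (((coboundary n).comp (BI X M n).subtype).codRestrict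
      (BI X M (n + 1)) fun f => coboundary_mem f.1 f.2))
    (fun n => by
      refine AddCommGrpCat.hom_ext (AddMonoidHom.ext fun f => ?_)
      exact Subtype.ext (coboundary_sq f.1))

end Cochains

/-! ### Twisting functions and equivariant twisted cohomology -/

/-- A twisting function `κ_q : B_q → Γ_{q-1}`, `q ≥ 1`, from a simplicial set to a group complex
(`toFun q` is `κ_{q+1}`). -/
structure TwistingFunction (B : SSet.{u}) (Γ : SimplicialObject GrpCat.{u}) where
  /-- the functions `κ_{q+1} : B_{q+1} → Γ_q` -/
  toFun (q : ℕ) : B _⦋q + 1⦌ → Γ _⦋q⦌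
  face_zero (q : ℕ) (b : B _⦋q + 2⦌) :
    Γ.δ 0 (toFun (q + 1) b) = (toFun q (B.δ 0 b))⁻¹ * toFun q (B.δ 1 b)
  face_succ (q : ℕ) (i : Fin (q + 1)) (b : B _⦋q + 2⦌) :
    Γ.δ i.succ (toFun (q + 1) b) = toFun q (B.δ i.succ.succ b)
  degen (q : ℕ) (i : Fin (q + 1)) (b : B _⦋q + 1⦌) :
    Γ.σ i (toFun q b) = toFun (q + 1) (B.σ i.succ b)
  degen_zero (q : ℕ) (b : B _⦋q⦌) : toFun q (B.σ 0 b) = 1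

/-- An `O_G`-twisting function: a natural family of twisting functions. -/
structure OTwistingFunction (B : (Orb G)ᵒᵖ ⥤ SSet.{u})
    (Γ : (Orb G)ᵒᵖ ⥤ SimplicialObject GrpCat.{u}) where
  /-- the twisting function `κ(G ⧸ H)` -/
  tw (U : (Orb G)ᵒᵖ) : TwistingFunction (B.obj U) (Γ.obj U)
  natural {U V : (Orb G)ᵒᵖ} (f : U ⟶ V) (q : ℕ) (b : B.obj U _⦋q + 1⦌) :
    (tw V).toFun q ((B.map f).app _ b) = (Γ.map f).app (op ⦋q⦌) ((tw U).toFun q b)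

/-- An `O_G`-group regarded as a trivial (constant) `O_G`-group complex. -/
abbrev trivialComplex (P : (Orb G)ᵒᵖ ⥤ GrpCat.{u}) : (Orb G)ᵒᵖ ⥤ SimplicialObject GrpCat.{u} :=
  P ⋙ Functor.const _

/-- An action of an `O_G`-group on an abelian `O_G`-group. -/
structure OAction (P : (Orb G)ᵒᵖ ⥤ GrpCat.{u}) (A : (Orb G)ᵒᵖ ⥤ AddCommGrpCat.{u}) where
  /-- the action of `P(G ⧸ H)` on `A(G ⧸ H)` by group automorphisms -/
  act (U : (Orb G)ᵒᵖ) : P.obj U →* AddMonoid.End (A.obj U)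
  natural {U V : (Orb G)ᵒᵖ} (f : U ⟶ V) (p : P.obj U) (m : A.obj U) :
    act V (P.map f p) (A.map f m) = A.map f (act U p m)

section Chains
variable {S T R : SSet.{u}} {n : ℕ}

open Classical in
/-- An `n`-simplex as an element of the free abelian group on the non-degenerate `n`-simplices,
degenerate simplices being `0`. -/
def gen (x : S _⦋n⦌) : FreeAbelianGroup (S.nonDegenerate n) :=
  if h : x ∈ S.nonDegenerate n then FreeAbelianGroup.of ⟨x, h⟩ else 0

lemma gen_of (x : S.nonDegenerate n) : gen x.1 = FreeAbelianGroup.of x := dif_pos x.2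

lemma gen_degenerate {x : S _⦋n⦌} (h : x ∈ S.degenerate n) : gen x = 0 := dif_neg fun h' => h' h

/-- The homomorphism of chain groups induced by a simplicial map. -/
def chainMap (n : ℕ) (f : S ⟶ T) :
    FreeAbelianGroup (S.nonDegenerate n) →+ FreeAbelianGroup (T.nonDegenerate n) :=
  FreeAbelianGroup.lift fun x => gen (f.app _ x.1)

lemma chainMap_of (f : S ⟶ T) (x : S.nonDegenerate n) :
    chainMap n f (FreeAbelianGroup.of x) = gen (f.app _ x.1) :=
  FreeAbelianGroup.lift_apply_of _ _

lemma chainMap_gen (f : S ⟶ T) (x : S _⦋n⦌) : chainMap n f (gen x) = gen (f.app _ x) := by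
  by_cases h : x ∈ S.degenerate n
  · rw [gen_degenerate h, gen_degenerate (SSet.degenerate_app_apply h f), map_zero]
  · exact (congrArg _ (gen_of ⟨x, h⟩)).trans (chainMap_of f ⟨x, h⟩)

/-- The functor `S ↦ Cₙ(S; ℤ)`, the free abelian group on the non-degenerate `n`-simplices. -/
def chains (n : ℕ) : SSet.{u} ⥤ AddCommGrpCat.{u} where
  obj S := AddCommGrpCat.of (FreeAbelianGroup (S.nonDegenerate n))
  map f := AddCommGrpCat.ofHom (chainMap n f)
  map_id S := by
    refine AddCommGrpCat.hom_ext (FreeAbelianGroup.lift_ext _ _ fun x => ?_)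
    exact (chainMap_of _ x).trans (gen_of x)
  map_comp {S T R} f g := by
    refine AddCommGrpCat.hom_ext (FreeAbelianGroup.lift_ext _ _ fun x => ?_)
    refine (chainMap_of _ x).trans ?_
    exact ((congrArg (chainMap n g) (chainMap_of f x)).trans (chainMap_gen g _)).symm

end Chains

section Twisted
variable {B : (Orb G)ᵒᵖ ⥤ SSet.{u}} {P : (Orb G)ᵒᵖ ⥤ GrpCat.{u}}
  {A : (Orb G)ᵒᵖ ⥤ AddCommGrpCat.{u}}

variable (B A) in
/-- The group `Hom(C̲ₙ, A)` of natural transformations, where `C̲ₙ(G ⧸ H) = Cₙ(B(G ⧸ H); ℤ)`. -/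
abbrev TwCoch (n : ℕ) : Type u := (B ⋙ chains n) ⟶ A

/-- The value `f(G ⧸ H)(x)` at an `n`-simplex `x` (it is `0` if `x` is degenerate). -/
def TwCoch.ev {n : ℕ} (f : TwCoch B A n) (U : (Orb G)ᵒᵖ) (x : B.obj U _⦋n⦌) : A.obj U :=
  (f.app U).hom (gen x)

variable (κ : OTwistingFunction B (trivialComplex P)) (φ : OAction P A)

/-- The element `κ(G ⧸ H)_{n+1}(x)` of the group `P(G ⧸ H)`. -/
def OTwistingFunction.val {n : ℕ} {U : (Orb G)ᵒᵖ} (x : B.obj U _⦋n + 1⦌) : P.obj U :=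
  (κ.tw U).toFun n x

/-- The value
`κ(G ⧸ H)(x)⁻¹ f(G ⧸ H)(∂₀ x) + ∑_{i ≥ 1} (-1)^i f(G ⧸ H)(∂ᵢ x)` of the twisted coboundary. -/
def twValue {n : ℕ} (f : TwCoch B A n) (U : (Orb G)ᵒᵖ) (x : B.obj U _⦋n + 1⦌) : A.obj U :=
  φ.act U (κ.val x)⁻¹ (f.ev U ((B.obj U).δ 0 x)) +
    ∑ i : Fin (n + 1), (-1 : ℤ) ^ ((i : ℕ) + 1) • f.ev U ((B.obj U).δ i.succ x)

/-- The `j`-th term of the twisted coboundary. -/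
def twTerm {n : ℕ} (j : Fin (n + 2)) {U : (Orb G)ᵒᵖ} (F : B.obj U _⦋n⦌ → A.obj U)
    (x : B.obj U _⦋n + 1⦌) : A.obj U :=
  Fin.cases (φ.act U (κ.val x)⁻¹ (F ((B.obj U).δ 0 x)))
    (fun i => F ((B.obj U).δ i.succ x)) j

lemma twValue_eq {n : ℕ} (f : TwCoch B A n) (U : (Orb G)ᵒᵖ) (x : B.obj U _⦋n + 1⦌) :
    twValue κ φ f U x = ∑ j : Fin (n + 2), (-1 : ℤ) ^ (j : ℕ) • twTerm κ φ j (f.ev U) x := by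
  rw [Fin.sum_univ_succ]
  simp [twValue, twTerm]

lemma TwCoch.ev_degenerate {n : ℕ} (f : TwCoch B A n) (U : (Orb G)ᵒᵖ) {x : B.obj U _⦋n⦌}
    (h : x ∈ (B.obj U).degenerate n) : f.ev U x = 0 := by
  unfold TwCoch.ev
  rw [gen_degenerate h]
  exact map_zero _

lemma TwCoch.ev_map {n : ℕ} (f : TwCoch B A n) {U V : (Orb G)ᵒᵖ} (g : U ⟶ V)
    (x : B.obj U _⦋n⦌) : f.ev V ((B.map g).app _ x) = A.map g (f.ev U x) := by
  refine Eq.trans ?_ (NatTrans.naturality_apply f g (gen x))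
  exact congrArg (f.app V).hom (chainMap_gen (B.map g) x).symm

lemma OTwistingFunction.val_map {n : ℕ} {U V : (Orb G)ᵒᵖ} (g : U ⟶ V) (x : B.obj U _⦋n + 1⦌) :
    κ.val ((B.map g).app _ x) = P.map g (κ.val x) := κ.natural g n x

lemma OTwistingFunction.val_face_zero {n : ℕ} {U : (Orb G)ᵒᵖ} (x : B.obj U _⦋n + 2⦌) :
    κ.val x = (κ.val ((B.obj U).δ 0 x))⁻¹ * κ.val ((B.obj U).δ 1 x) := (κ.tw U).face_zero n x

lemma OTwistingFunction.val_face_succ {n : ℕ} {U : (Orb G)ᵒᵖ} (i : Fin (n + 1))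
    (x : B.obj U _⦋n + 2⦌) : κ.val x = κ.val ((B.obj U).δ i.succ.succ x) :=
  (κ.tw U).face_succ n i x

lemma OTwistingFunction.val_degen_zero {n : ℕ} {U : (Orb G)ᵒᵖ} (x : B.obj U _⦋n⦌) :
    κ.val ((B.obj U).σ 0 x) = 1 := (κ.tw U).degen_zero n x

lemma twValue_degenerate {n : ℕ} (f : TwCoch B A n) (U : (Orb G)ᵒᵖ) {x : B.obj U _⦋n + 1⦌}
    (h : x ∈ (B.obj U).degenerate (n + 1)) : twValue κ φ f U x = 0 := by
  rw [SSet.degenerate_eq_iUnion_range_σ, Set.mem_iUnion] at h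
  obtain ⟨i, y, rfl⟩ := h
  rw [twValue_eq]
  refine altSum_degen _ i (fun j h1 h2 => ?_) ?_
  · have h0 := f.ev_degenerate U (delta_sigma_degenerate _ i y j h1 h2)
    cases j using Fin.cases with
    | zero =>
      exact (congrArg (φ.act U _) h0).trans (map_zero (φ.act U _ : AddMonoid.End (A.obj U)))
    | succ j => exact h0
  · have e1 := SSet.δ_comp_σ_self_apply i y
    have e2 := SSet.δ_comp_σ_succ_apply i y
    have h2 : twTerm κ φ i.succ (f.ev U) ((B.obj U).σ i y) = f.ev U y := congrArg (f.ev U) e2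
    rw [h2]
    cases i using Fin.cases with
    | zero =>
      change φ.act U (κ.val ((B.obj U).σ 0 y))⁻¹ (f.ev U ((B.obj U).δ 0 ((B.obj U).σ 0 y))) = _
      rw [κ.val_degen_zero, inv_one, map_one]
      exact congrArg (f.ev U) e1
    | succ i => exact congrArg (f.ev U) e1

lemma twValue_map {n : ℕ} (f : TwCoch B A n) {U V : (Orb G)ᵒᵖ} (g : U ⟶ V)
    (x : B.obj U _⦋n + 1⦌) :
    twValue κ φ f V ((B.map g).app _ x) = A.map g (twValue κ φ f U x) := by
  unfold twValue
  refine Eq.trans ?_ (map_add (A.map g).hom _ _).symm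
  rw [map_sum]
  congr 1
  · refine Eq.trans ?_ (φ.natural g _ _)
    have h1 : (κ.val ((B.map g).app _ x))⁻¹ = P.map g (κ.val x)⁻¹ := by
      rw [κ.val_map]
      exact (map_inv (P.map g).hom _).symm
    rw [h1, ← SSet.δ_naturality_apply, f.ev_map]
  · refine Finset.sum_congr rfl fun i _ => ?_
    rw [map_zsmul, ← SSet.δ_naturality_apply, f.ev_map]

/-- The homomorphism `Cₙ(S; ℤ) → N` with the given values on simplices, which vanish on the
degenerate ones. -/
def liftGen {S : SSet.{u}} {n : ℕ} {N : Type u} [AddCommGroup N] (F : S _⦋n⦌ → N) :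
    FreeAbelianGroup (S.nonDegenerate n) →+ N :=
  FreeAbelianGroup.lift fun x => F x.1

lemma liftGen_gen {S : SSet.{u}} {n : ℕ} {N : Type u} [AddCommGroup N] (F : S _⦋n⦌ → N)
    (hF : ∀ x ∈ S.degenerate n, F x = 0) (x : S _⦋n⦌) : liftGen F (gen x) = F x := by
  by_cases h : x ∈ S.degenerate n
  · rw [gen_degenerate h, hF x h, map_zero]
  · exact (congrArg _ (gen_of ⟨x, h⟩)).trans (FreeAbelianGroup.lift_apply_of _ _)

/-- The cochain with given values on simplices. -/
def TwCoch.mk {n : ℕ} (F : ∀ U, B.obj U _⦋n⦌ → A.obj U)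
    (h0 : ∀ U, ∀ x ∈ (B.obj U).degenerate n, F U x = 0)
    (h : ∀ {U V : (Orb G)ᵒᵖ} (g : U ⟶ V) (x : B.obj U _⦋n⦌),
      F V ((B.map g).app _ x) = A.map g (F U x)) : TwCoch B A n where
  app U := AddCommGrpCat.ofHom (liftGen (F U))
  naturality U V g := by
    refine AddCommGrpCat.hom_ext (FreeAbelianGroup.lift_ext _ _ fun x => ?_)
    change liftGen (F V) (chainMap n (B.map g) (FreeAbelianGroup.of x)) =
      A.map g (liftGen (F U) (FreeAbelianGroup.of x))
    rw [← gen_of, chainMap_gen, liftGen_gen _ (h0 V), liftGen_gen _ (h0 U), h]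

lemma TwCoch.mk_ev {n : ℕ} (F : ∀ U, B.obj U _⦋n⦌ → A.obj U)
    (h0 : ∀ U, ∀ x ∈ (B.obj U).degenerate n, F U x = 0)
    (h : ∀ {U V : (Orb G)ᵒᵖ} (g : U ⟶ V) (x : B.obj U _⦋n⦌),
      F V ((B.map g).app _ x) = A.map g (F U x)) (U) (x : B.obj U _⦋n⦌) :
    (TwCoch.mk F h0 h).ev U x = F U x :=
  liftGen_gen (F U) (h0 U) x

lemma TwCoch.ext_ev {n : ℕ} {f g : TwCoch B A n} (h : ∀ U x, f.ev U x = g.ev U x) : f = g := by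
  refine NatTrans.ext (funext fun U => AddCommGrpCat.hom_ext
    (FreeAbelianGroup.lift_ext _ _ fun x => ?_))
  have := h U x.1
  unfold TwCoch.ev at this
  rwa [gen_of] at this

lemma TwCoch.ev_add {n : ℕ} (f g : TwCoch B A n) (U) (x : B.obj U _⦋n⦌) :
    (f + g).ev U x = f.ev U x + g.ev U x := rfl

lemma TwCoch.ev_zero {n : ℕ} (U) (x : B.obj U _⦋n⦌) :
    (0 : TwCoch B A n).ev U x = 0 := rfl

/-- The twisted coboundary `δ_κ`. -/
def twDelta (n : ℕ) : TwCoch B A n →+ TwCoch B A (n + 1) where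
  toFun f := TwCoch.mk (twValue κ φ f) (fun U _ => twValue_degenerate κ φ f U)
    (fun g => twValue_map κ φ f g)
  map_zero' := by
    refine TwCoch.ext_ev fun U x => ?_
    rw [TwCoch.mk_ev]
    simp only [twValue, TwCoch.ev_zero, smul_zero, Finset.sum_const_zero, add_zero]
    exact map_zero (φ.act U _ : AddMonoid.End (A.obj U))
  map_add' f g := by
    refine TwCoch.ext_ev fun U x => ?_
    rw [TwCoch.ev_add, TwCoch.mk_ev, TwCoch.mk_ev, TwCoch.mk_ev]
    simp only [twValue, TwCoch.ev_add, smul_add, Finset.sum_add_distrib]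
    rw [map_add (φ.act U _ : AddMonoid.End (A.obj U))]
    abel

lemma twDelta_ev {n : ℕ} (f : TwCoch B A n) (U : (Orb G)ᵒᵖ) (x : B.obj U _⦋n + 1⦌) :
    (twDelta κ φ n f).ev U x = twValue κ φ f U x :=
  TwCoch.mk_ev (twValue κ φ f) (fun U _ => twValue_degenerate κ φ f U)
    (fun g => twValue_map κ φ f g) U x

lemma twDelta_sq {n : ℕ} (f : TwCoch B A n) : twDelta κ φ (n + 1) (twDelta κ φ n f) = 0 := by
  refine TwCoch.ext_ev fun U x => ?_
  rw [twDelta_ev, twValue_eq, TwCoch.ev_zero]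
  have h : ∀ j : Fin (n + 3), twTerm κ φ j ((twDelta κ φ n f).ev U) x =
      ∑ i : Fin (n + 2), (-1 : ℤ) ^ (i : ℕ) • twTerm κ φ j (twTerm κ φ i (f.ev U)) x := by
    intro j
    cases j using Fin.cases with
    | zero =>
      change φ.act U (κ.val x)⁻¹ ((twDelta κ φ n f).ev U _) = ∑ i : Fin (n + 2), (-1 : ℤ) ^ (i : ℕ) •
        φ.act U (κ.val x)⁻¹ (twTerm κ φ i (f.ev U) _)
      rw [twDelta_ev, twValue_eq, map_sum (φ.act U _ : AddMonoid.End (A.obj U))]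
      exact Finset.sum_congr rfl fun i _ => map_zsmul (φ.act U _ : AddMonoid.End (A.obj U)) _ _
    | succ j =>
      change (twDelta κ φ n f).ev U _ = ∑ i : Fin (n + 2), (-1 : ℤ) ^ (i : ℕ) •
        twTerm κ φ i (f.ev U) _
      rw [twDelta_ev, twValue_eq]
  simp only [h]
  refine altSum_sq n (fun j i => twTerm κ φ j (twTerm κ φ i (f.ev U)) x) fun i j hij => ?_
  have hδ := fun (i j : Fin (n + 2)) (hij : i ≤ j) =>
    congrArg (f.ev U) (SSet.δ_comp_δ_apply hij x)
  cases i using Fin.cases with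
  | zero =>
    cases j using Fin.cases with
    | zero =>
      change φ.act U (κ.val ((B.obj U).δ 1 x))⁻¹ (f.ev U ((B.obj U).δ 0 ((B.obj U).δ 1 x))) =
        φ.act U (κ.val x)⁻¹ (φ.act U (κ.val ((B.obj U).δ 0 x))⁻¹
          (f.ev U ((B.obj U).δ 0 ((B.obj U).δ 0 x))))
      have h1 := hδ 0 0 le_rfl
      have h2 : (κ.val ((B.obj U).δ 1 x))⁻¹ = (κ.val x)⁻¹ * (κ.val ((B.obj U).δ 0 x))⁻¹ := by
        rw [κ.val_face_zero x]
        group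
      rw [h2, map_mul]
      exact congrArg (fun a => φ.act U (κ.val x)⁻¹ (φ.act U (κ.val ((B.obj U).δ 0 x))⁻¹ a)) h1
    | succ j =>
      change φ.act U (κ.val ((B.obj U).δ j.succ.succ x))⁻¹
        (f.ev U ((B.obj U).δ 0 ((B.obj U).δ j.succ.succ x))) =
        φ.act U (κ.val x)⁻¹ (f.ev U ((B.obj U).δ j.succ ((B.obj U).δ 0 x)))
      rw [← κ.val_face_succ j x]
      exact congrArg (φ.act U (κ.val x)⁻¹) (hδ 0 j.succ (Fin.zero_le _))
  | succ i =>
    cases j using Fin.cases with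
    | zero => exact absurd hij (by simp)
    | succ j => exact hδ i.succ j.succ hij

/-- The cochain complex of the groups `Hom(C̲ₙ, A)` and the coboundary `δ_κ`. For `B = ΦX` it is
the complex `C_G(X; κ, φ)`. -/
def TwComplex : CochainComplex AddCommGrpCat.{u} ℕ :=
  CochainComplex.of (fun n => AddCommGrpCat.of (TwCoch B A n))
    (fun n => AddCommGrpCat.ofHom (twDelta κ φ n))
    (fun n => by
      refine AddCommGrpCat.hom_ext (AddMonoidHom.ext fun f => ?_)
      exact twDelta_sq κ φ f)

end Twisted

/-! ### Paths between vertices of a simplicial set -/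

section Paths
variable {S T R : SSet.{u}} {m n : ℕ}

/-- A vertex of `S` as an object of the fundamental groupoid of `|S|`, that is, of the
fundamental groupoid of the Kan complex `S|S|`. -/
abbrev vtx (x : S _⦋0⦌) : FundamentalGroupoid |S| := FundamentalGroupoid.mk (pt x)

/-- The class of a path from `x` to `y`. -/
def cls {x y : S _⦋0⦌} (p : Path (pt x) (pt y)) : vtx x ⟶ vtx y := Path.Homotopic.Quotient.mk p

lemma cls_congr {x y : S _⦋0⦌} {p q : Path (pt x) (pt y)} (h : ∀ t, p t = q t) : cls p = cls q :=
  congrArg cls (Path.ext (funext h))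

lemma cls_surjective {x y : S _⦋0⦌} (α : vtx x ⟶ vtx y) : ∃ p, cls p = α :=
  Path.Homotopic.Quotient.mk_surjective α

lemma cls_comp {x y z : S _⦋0⦌} (p : Path (pt x) (pt y)) (q : Path (pt y) (pt z)) :
    cls p ≫ cls q = cls (p.trans q) := rfl

/-- The image of a path class under a simplicial map `f`. -/
def push (f : S ⟶ T) {x y : S _⦋0⦌} {x' y' : T _⦋0⦌} (hx : f.app _ x = x') (hy : f.app _ y = y')
    (α : vtx x ⟶ vtx y) : vtx x' ⟶ vtx y' :=
  (Path.Homotopic.Quotient.map (show Path.Homotopic.Quotient (pt x) (pt y) from α)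
    (SSet.toTop.map f).hom).cast
    ((congrArg pt hx.symm).trans (map_pt f x).symm) ((congrArg pt hy.symm).trans (map_pt f y).symm)

lemma push_comp (f : S ⟶ T) {x y z : S _⦋0⦌} {x' y' z' : T _⦋0⦌} (hx : f.app _ x = x')
    (hy : f.app _ y = y') (hz : f.app _ z = z') (α : vtx x ⟶ vtx y) (β : vtx y ⟶ vtx z) :
    push f hx hz (α ≫ β) = push f hx hy α ≫ push f hy hz β := by
  obtain ⟨p, rfl⟩ := cls_surjective α
  obtain ⟨q, rfl⟩ := cls_surjective β
  refine cls_congr (p := ((p.trans q).map _).cast _ _) (q := ((p.map _).cast _ _).trans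
    ((q.map _).cast _ _)) fun t => ?_
  refine Eq.trans (congrArg (SSet.toTop.map f).hom (Path.trans_apply p q t))
    (Eq.trans ?_ (Path.trans_apply _ _ t).symm)
  split_ifs <;> rfl

lemma push_inv (f : S ⟶ T) {x y : S _⦋0⦌} {x' y' : T _⦋0⦌} (hx : f.app _ x = x')
    (hy : f.app _ y = y') (α : vtx x ⟶ vtx y) :
    push f hy hx (inv α) = inv (push f hx hy α) := by
  obtain ⟨p, rfl⟩ := cls_surjective α
  rw [← Groupoid.inv_eq_inv, ← Groupoid.inv_eq_inv]
  rfl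

lemma push_push (f : S ⟶ T) (g : T ⟶ R) (h : S ⟶ R) (hfg : f ≫ g = h) {x y : S _⦋0⦌}
    {x' y' : T _⦋0⦌} {x'' y'' : R _⦋0⦌} (hx : f.app _ x = x') (hy : f.app _ y = y')
    (hx' : g.app _ x' = x'') (hy' : g.app _ y' = y'')
    (hx'' : h.app _ x = x'') (hy'' : h.app _ y = y'') (α : vtx x ⟶ vtx y) :
    push g hx' hy' (push f hx hy α) = push h hx'' hy'' α := by
  obtain ⟨p, rfl⟩ := cls_surjective α
  subst hfg
  refine cls_congr (p := (((p.map _).cast _ _).map _).cast _ _) (q := (p.map _).cast _ _)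
    fun t => ?_
  change (SSet.toTop.map g) ((SSet.toTop.map f) (p t)) = (SSet.toTop.map (f ≫ g)) (p t)
  rw [Functor.map_comp]
  rfl

lemma push_id (f : S ⟶ S) (hf : f = 𝟙 S) {x y : S _⦋0⦌} (hx : f.app _ x = x)
    (hy : f.app _ y = y) (α : vtx x ⟶ vtx y) : push f hx hy α = α := by
  obtain ⟨p, rfl⟩ := cls_surjective α
  subst hf
  refine cls_congr (p := (p.map _).cast _ _) fun t => ?_
  change (SSet.toTop.map (𝟙 S)) (p t) = p t
  rw [CategoryTheory.Functor.map_id]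
  rfl

/-- The class of the image in `|S|` of a path in `Δⁿ` between two vertices. -/
def simplexPath (s : S _⦋n⦌) {i j : Fin (n + 1)}
    (p : Path (stdSimplex.vertex i : stdSimplex ℝ (Fin (n + 1))) (stdSimplex.vertex j))
    {x y : S _⦋0⦌} (hx : S.map (SimplexCategory.const ⦋0⦌ ⦋n⦌ i).op s = x)
    (hy : S.map (SimplexCategory.const ⦋0⦌ ⦋n⦌ j).op s = y) : vtx x ⟶ vtx y :=
  cls ((p.map (chi s).continuous).cast (by rw [chi_vertex, hx]) (by rw [chi_vertex, hy]))

lemma simplexPath_congr (s : S _⦋n⦌) {i j : Fin (n + 1)}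
    (p q : Path (stdSimplex.vertex i : stdSimplex ℝ (Fin (n + 1))) (stdSimplex.vertex j))
    {x y : S _⦋0⦌} (hx : S.map (SimplexCategory.const ⦋0⦌ ⦋n⦌ i).op s = x)
    (hy : S.map (SimplexCategory.const ⦋0⦌ ⦋n⦌ j).op s = y) :
    simplexPath s p hx hy = simplexPath s q hx hy :=
  Path.Homotopic.Quotient.eq.2
    (((SimplyConnectedSpace.paths_homotopic p q).map (chi s)).pathCast _ _)

/-- The class of the edge from the vertex `i` to the vertex `j` of `s`. -/
def vPath (s : S _⦋n⦌) (i j : Fin (n + 1))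
    {x y : S _⦋0⦌} (hx : S.map (SimplexCategory.const ⦋0⦌ ⦋n⦌ i).op s = x)
    (hy : S.map (SimplexCategory.const ⦋0⦌ ⦋n⦌ j).op s = y) : vtx x ⟶ vtx y :=
  simplexPath s (PathConnectedSpace.somePath (stdSimplex.vertex i) (stdSimplex.vertex j)) hx hy

lemma vPath_comp (s : S _⦋n⦌) (i j k : Fin (n + 1)) {x y z : S _⦋0⦌}
    (hx : S.map (SimplexCategory.const ⦋0⦌ ⦋n⦌ i).op s = x)
    (hy : S.map (SimplexCategory.const ⦋0⦌ ⦋n⦌ j).op s = y)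
    (hz : S.map (SimplexCategory.const ⦋0⦌ ⦋n⦌ k).op s = z) :
    vPath s i j hx hy ≫ vPath s j k hy hz = vPath s i k hx hz := by
  let p := PathConnectedSpace.somePath (stdSimplex.vertex i : stdSimplex ℝ (Fin (n + 1)))
    (stdSimplex.vertex j)
  let q := PathConnectedSpace.somePath (stdSimplex.vertex j : stdSimplex ℝ (Fin (n + 1)))
    (stdSimplex.vertex k)
  refine Eq.trans ?_ (simplexPath_congr s (p.trans q) _ hx hz)
  refine cls_congr (p := ((p.map _).cast _ _).trans ((q.map _).cast _ _))
    (q := ((p.trans q).map _).cast _ _) fun t => ?_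
  refine Eq.trans (Path.trans_apply _ _ t) ?_
  refine Eq.trans ?_ (congrArg (chi s) (Path.trans_apply p q t)).symm
  split_ifs <;> rfl

lemma vPath_self (s : S _⦋n⦌) (i : Fin (n + 1)) {x : S _⦋0⦌}
    (hx : S.map (SimplexCategory.const ⦋0⦌ ⦋n⦌ i).op s = x) : vPath s i i hx hx = 𝟙 (vtx x) := by
  refine (simplexPath_congr s _ (Path.refl _) hx hx).trans ?_
  refine cls_congr (p := ((Path.refl _).map _).cast _ _) (q := Path.refl _) fun t => ?_
  exact (chi_vertex s i).trans (congrArg pt hx)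

lemma map_const_map (s : S _⦋n⦌) (θ : ⦋m⦌ ⟶ ⦋n⦌) (i : Fin (m + 1)) :
    S.map (SimplexCategory.const ⦋0⦌ ⦋m⦌ i).op (S.map θ.op s) =
      S.map (SimplexCategory.const ⦋0⦌ ⦋n⦌ (θ i)).op s := by
  rw [← Functor.map_comp_apply, ← op_comp, SimplexCategory.const_comp]
  rfl

lemma vPath_map (s : S _⦋n⦌) (θ : ⦋m⦌ ⟶ ⦋n⦌) (i j : Fin (m + 1)) {x y : S _⦋0⦌}
    (hx : S.map (SimplexCategory.const ⦋0⦌ ⦋m⦌ i).op (S.map θ.op s) = x)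
    (hy : S.map (SimplexCategory.const ⦋0⦌ ⦋m⦌ j).op (S.map θ.op s) = y) :
    vPath (S.map θ.op s) i j hx hy =
      vPath s (θ i) (θ j) ((map_const_map s θ i).symm.trans hx)
        ((map_const_map s θ j).symm.trans hy) := by
  let p := PathConnectedSpace.somePath (stdSimplex.vertex i : stdSimplex ℝ (Fin (m + 1)))
    (stdSimplex.vertex j)
  refine Eq.trans ?_ (simplexPath_congr s ((p.map (stdSimplex.continuous_map θ)).cast
    (stdSimplex.map_vertex _ _).symm (stdSimplex.map_vertex _ _).symm) _ _ _)
  refine cls_congr (p := (p.map _).cast _ _) (q := ((((p.map _).cast _ _)).map _).cast _ _)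
    fun t => chi_map θ s (p t)

lemma push_simplexPath (f : S ⟶ T) (s : S _⦋n⦌) {i j : Fin (n + 1)}
    (p : Path (stdSimplex.vertex i : stdSimplex ℝ (Fin (n + 1))) (stdSimplex.vertex j))
    {x y : S _⦋0⦌} {x' y' : T _⦋0⦌}
    (hx : S.map (SimplexCategory.const ⦋0⦌ ⦋n⦌ i).op s = x)
    (hy : S.map (SimplexCategory.const ⦋0⦌ ⦋n⦌ j).op s = y)
    (hx' : f.app _ x = x') (hy' : f.app _ y = y')
    (kx : T.map (SimplexCategory.const ⦋0⦌ ⦋n⦌ i).op (f.app _ s) = x')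
    (ky : T.map (SimplexCategory.const ⦋0⦌ ⦋n⦌ j).op (f.app _ s) = y') :
    push f hx' hy' (simplexPath s p hx hy) = simplexPath (f.app _ s) p kx ky := by
  refine cls_congr (p := ((((p.map _).cast _ _)).map _).cast _ _) (q := (p.map _).cast _ _)
    fun t => map_chi f s (p t)

/-- The class of the path given by a `1`-simplex. -/
def edgeClass (e : S _⦋1⦌) {x y : S _⦋0⦌} (hx : S.δ 1 e = x) (hy : S.δ 0 e = y) :
    vtx x ⟶ vtx y := cls (edgePath e hx hy)

lemma edgeClass_eq (e : S _⦋1⦌) {x y : S _⦋0⦌} (hx : S.δ 1 e = x) (hy : S.δ 0 e = y) :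
    edgeClass e hx hy = vPath e 0 1 (by rw [← hx, ← SimplexCategory.δ_one_eq_const]; rfl)
      (by rw [← hy, ← SimplexCategory.δ_zero_eq_const]; rfl) :=
  simplexPath_congr e unitPath _ _ _

end Paths

namespace GSSet
open ESimplex
variable {X : GSSet G}

/-! ### The `O_G`-group `π̲X` -/

section Base
variable {v : X.V _⦋0⦌} (hv : ∀ g : G, X.act g v = v)

/-- The fixed vertex `v`, as a vertex of `X^H`. -/
def vfix (U : Orb G) : (X.fixed U.sub : SSet.{u}) _⦋0⦌ := ⟨v, fun h _ => hv h⟩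

lemma fixedMap_vfix {U V : Orb G} (f : U ⟶ V) :
    (X.fixedMap f).app _ (vfix hv V) = vfix hv U :=
  Subtype.ext (hv _)

/-- For `f : G ⧸ H → G ⧸ K`, `f (eH) = gK`, the homomorphism `π₁(X^K, v) → π₁(X^H, v)` induced
by `g : X^K → X^H`. Here `π₁(X^H, v)` is the fundamental group of `|X^H|`; Mathlib's product
`α * β` in it is the composite `α ∘ β` in the fundamental groupoid. -/
def piMap {U V : Orb G} (f : U ⟶ V) :
    FundamentalGroup |(X.fixed V.sub : SSet.{u})| (pt (vfix hv V)) →*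
      FundamentalGroup |(X.fixed U.sub : SSet.{u})| (pt (vfix hv U)) :=
  FundamentalGroup.mapOfEq (SSet.toTop.map (X.fixedMap f)).hom
    ((map_pt _ _).trans (congrArg pt (fixedMap_vfix hv f)))

lemma piMap_apply {U V : Orb G} (f : U ⟶ V)
    (α : FundamentalGroup |(X.fixed V.sub : SSet.{u})| (pt (vfix hv V))) :
    piMap hv f α = push (X.fixedMap f) (fixedMap_vfix hv f) (fixedMap_vfix hv f) α :=
  FundamentalGroup.mapOfEq_apply (SSet.toTop.map (X.fixedMap f)).hom
    ((map_pt _ _).trans (congrArg pt (fixedMap_vfix hv f))) α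

/-- The `O_G`-group `π̲X`, `G ⧸ H ↦ π₁(X^H, v)`. -/
def piX : (Orb G)ᵒᵖ ⥤ GrpCat.{u} where
  obj U := GrpCat.of (FundamentalGroup |(X.fixed U.unop.sub : SSet.{u})| (pt (vfix hv U.unop)))
  map f := GrpCat.ofHom (piMap hv f.unop)
  map_id U := by
    refine GrpCat.hom_ext (MonoidHom.ext fun α => ?_)
    exact (piMap_apply hv (𝟙 U.unop) α).trans (push_id _ (X.Phi.map_id U) _ _ α)
  map_comp {U V W} f g := by
    refine GrpCat.hom_ext (MonoidHom.ext fun α => ?_)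
    refine (piMap_apply hv (g.unop ≫ f.unop) α).trans ?_
    refine Eq.trans ?_ ((piMap_apply hv g.unop _).trans
      (congrArg _ (piMap_apply hv f.unop α))).symm
    exact (push_push (X.fixedMap f.unop) (X.fixedMap g.unop) (X.fixedMap (g.unop ≫ f.unop))
      (X.Phi.map_comp f g).symm (fixedMap_vfix hv f.unop) (fixedMap_vfix hv f.unop)
      (fixedMap_vfix hv g.unop) (fixedMap_vfix hv g.unop) _ _ α).symm

lemma piX_map {U V : (Orb G)ᵒᵖ} (f : U ⟶ V) (α : (piX hv).obj U) :
    (piX hv).map f α = push (X.fixedMap f.unop) (fixedMap_vfix hv f.unop)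
      (fixedMap_vfix hv f.unop) α :=
  piMap_apply hv f.unop α

end Base
end GSSet

namespace GSSet
open ESimplex
variable {X : GSSet G}

/-! ### The abelian `O_G`-group `M₀` and its `π̲X`-action -/

section Base
variable {v : X.V _⦋0⦌} (hv : ∀ g : G, X.act g v = v)

/-- The map `|X^H| → |X|` induced by the inclusion. -/
def incl (U : Orb G) : C(|(X.fixed U.sub : SSet.{u})|, |X.V|) :=
  (SSet.toTop.map (X.fixed U.sub).ι).hom

lemma topAct_incl (U : Orb G) (h : G) (hh : h ∈ U.sub) (z : |(X.fixed U.sub : SSet.{u})|) :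
    X.topAct h (incl U z) = incl U z := by
  have e : (X.fixed U.sub).ι ≫ (show X.V ⟶ X.V from X.ρ h) = (X.fixed U.sub).ι := by
    ext n x
    exact x.2 h hh
  change SSet.toTop.map (show X.V ⟶ X.V from X.ρ h) (SSet.toTop.map (X.fixed U.sub).ι z) = _
  rw [← CategoryTheory.comp_apply, ← Functor.map_comp, e]
  rfl

lemma topAct_incl_eq (U : Orb G) {g g' : G}
    (h : (QuotientGroup.mk g : U.coset) = QuotientGroup.mk g')
    (z : |(X.fixed U.sub : SSet.{u})|) :
    X.topAct g (incl U z) = X.topAct g' (incl U z) := by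
  have := topAct_incl U _ (QuotientGroup.eq.1 h) z
  conv_lhs => rw [← this]
  rw [← topAct_mul, mul_inv_cancel_left]

/-- The map which sends a point `z` of `|X^H|` to the `G`-map `G ⧸ H → |X|`, `gH ↦ g z`. -/
def jMap (U : Orb G) : C(|(X.fixed U.sub : SSet.{u})|, X.OrbitMap U) where
  toFun z := ⟨fun a => X.topAct (Quotient.out a) (incl U z), fun g a => by
    obtain ⟨b, rfl⟩ := QuotientGroup.mk_surjective a
    rw [← topAct_mul]
    apply topAct_incl_eq
    refine (Quotient.out_eq _).trans ?_
    change g • (QuotientGroup.mk b : U.coset) = g • (QuotientGroup.mk (Quotient.out _) : U.coset)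
    exact congrArg (g • ·) (Quotient.out_eq (QuotientGroup.mk b : U.coset)).symm⟩
  continuous_toFun := by
    refine Continuous.subtype_mk (continuous_pi fun a => ?_) _
    exact (X.topAct _).continuous.comp (incl U).continuous

lemma jMap_mk (U : Orb G) (z : |(X.fixed U.sub : SSet.{u})|) (g : G) :
    (jMap U z).1 (QuotientGroup.mk g) = X.topAct g (incl U z) :=
  topAct_incl_eq U (Quotient.out_eq _) z

lemma jMap_base (U : Orb G) (z : |(X.fixed U.sub : SSet.{u})|) :
    (jMap U z).1 U.base = incl U z := by
  rw [jMap_mk, topAct_one]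

lemma jMap_fixedMap {U V : Orb G} (f : U ⟶ V) (z : |(X.fixed V.sub : SSet.{u})|) :
    jMap U (SSet.toTop.map (X.fixedMap f) z) = X.precomp f (jMap V z) := by
  apply OrbitMap.ext_base
  rw [jMap_base]
  change _ = (jMap V z).1 (Orb.fn f U.base)
  rw [← Orb.mk_elt, jMap_mk]
  change SSet.toTop.map (X.fixed U.sub).ι (SSet.toTop.map (X.fixedMap f) z) =
    SSet.toTop.map (show X.V ⟶ X.V from X.ρ (Orb.elt f)) (SSet.toTop.map (X.fixed V.sub).ι z)
  rw [← CategoryTheory.comp_apply, ← Functor.map_comp, ← CategoryTheory.comp_apply,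
    ← Functor.map_comp]
  rfl

lemma obj_point_eq {U : Orb G} {s : ESimplex X U 0} {x : (X.fixed U.sub : SSet.{u}) _⦋0⦌}
    (hs : s.simplex = x) : s.obj.point = jMap U (pt x) := by
  refine OrbitMap.ext_base (U := U) (Eq.trans ?_ (jMap_base U (pt x)).symm)
  rw [← hs]
  exact (map_pt (X.fixed U.sub).ι s.simplex).symm

/-- For equivariant `0`-simplices `s`, `t` of type `H`, corresponding to the vertices `x`, `y` of
`X^H`, and a morphism `α : x → y` of the fundamental groupoid of `X^H`, the morphism
`bα = [id, α] : s → t` of `ΠX`. -/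
def bHom {U : Orb G} {s t : ESimplex X U 0} {x y : (X.fixed U.sub : SSet.{u}) _⦋0⦌}
    (hs : s.simplex = x) (ht : t.simplex = y) (α : vtx x ⟶ vtx y) : s.obj ⟶ t.obj :=
  FundGpd.homMk (x := s.obj) (y := t.obj) (𝟙 U)
    ((Path.Homotopic.Quotient.map (show Path.Homotopic.Quotient (pt x) (pt y) from α)
      (jMap U)).cast (obj_point_eq hs) (obj_point_eq ht))

section bHom
variable {U V : Orb G} {s t r : ESimplex X U 0} {x y z : (X.fixed U.sub : SSet.{u}) _⦋0⦌}

lemma bHom_comp (hs : s.simplex = x) (ht : t.simplex = y) (hr : r.simplex = z)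
    (α : vtx x ⟶ vtx y) (β : vtx y ⟶ vtx z) :
    bHom hs hr (α ≫ β) = bHom hs ht α ≫ bHom ht hr β := by
  obtain ⟨p, rfl⟩ := cls_surjective α
  obtain ⟨q, rfl⟩ := cls_surjective β
  refine congrArg (FundGpd.homMk (x := s.obj) (y := r.obj) (𝟙 U)) ?_
  refine congrArg Path.Homotopic.Quotient.mk ?_
  refine Path.ext (funext fun t => ?_)
  refine Eq.trans (congrArg (jMap U) (Path.trans_apply p q t)) ?_
  refine Eq.trans ?_ (Path.trans_apply _ _ t).symm
  split_ifs <;> rfl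

lemma bHom_id (hs : s.simplex = x) : bHom hs hs (𝟙 (vtx x)) = 𝟙 s.obj := by
  refine congrArg (FundGpd.homMk (x := s.obj) (y := s.obj) (𝟙 U)) ?_
  refine congrArg Path.Homotopic.Quotient.mk ?_
  exact Path.ext (funext fun t => (obj_point_eq hs).symm)

lemma alongHom_bHom {s' t' : ESimplex X V 0} {x' y' : (X.fixed V.sub : SSet.{u}) _⦋0⦌}
    (f : U ⟶ V) (hs : s.simplex = x) (ht : t.simplex = y)
    (hs' : s'.simplex = x') (ht' : t'.simplex = y')
    (h : s'.along f = s) (h' : t'.along f = t)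
    (kx : (X.fixedMap f).app _ x' = x) (ky : (X.fixedMap f).app _ y' = y)
    (α : vtx x' ⟶ vtx y') :
    alongHom f h ≫ bHom hs' ht' α = bHom hs ht (push (X.fixedMap f) kx ky α) ≫ alongHom f h' := by
  obtain ⟨p, rfl⟩ := cls_surjective α
  subst h h'
  refine (FundGpd.homConst_comp (y := ESimplex.obj _) (z := ESimplex.obj _) _ _ _ _).trans
    (Eq.trans ?_ (FundGpd.comp_homConst (x := ESimplex.obj _) (y := ESimplex.obj _)
      (z := ESimplex.obj _) _ _ _ _).symm)
  refine congrArg (FundGpd.homMk (x := ESimplex.obj _) (y := ESimplex.obj _) f) ?_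
  refine congrArg Path.Homotopic.Quotient.mk ?_
  exact Path.ext (funext fun t => (jMap_fixedMap f (p t)).symm)

end bHom

variable (v) in
/-- The object `v_H` of `ΠX`: the equivariant `0`-simplex `G ⧸ H × Δ[0] → X` of type `H`, constant
at `v`. -/
def vSimplex (U : Orb G) : ESimplex X U 0 where
  hom :=
    { app := fun m => ↾fun _ => X.V.map (SimplexCategory.const m.unop ⦋0⦌ 0).op v
      naturality := fun m m' θ => by
        ext p
        change X.V.map (SimplexCategory.const m'.unop ⦋0⦌ 0).op v =
          X.V.map θ (X.V.map (SimplexCategory.const m.unop ⦋0⦌ 0).op v)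
        rw [← Functor.map_comp_apply]
        rfl }
  comm g := by
    ext m p
    change X.V.map _ v = X.act g (X.V.map _ v)
    rw [act_map, hv]

lemma vSimplex_val (U : Orb G) (a : U.coset) : (vSimplex v hv U).val a = v := by
  change X.V.map _ v = v
  rw [show (SimplexCategory.const ⦋0⦌ ⦋0⦌ 0).op = 𝟙 (op ⦋0⦌) from
    congrArg Quiver.Hom.op (Subsingleton.elim _ (𝟙 ⦋0⦌)), Functor.map_id_apply]

lemma vSimplex_simplex (U : Orb G) : (vSimplex v hv U).simplex = vfix hv U :=
  Subtype.ext (vSimplex_val hv U _)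

lemma vSimplex_along {U V : Orb G} (f : U ⟶ V) : (vSimplex v hv V).along f = vSimplex v hv U := by
  apply simplex_injective
  rw [simplex_along, vSimplex_simplex, vSimplex_simplex, fixedMap_vfix]

/-- The morphism `[f, k] : v_H → v_K` of `ΠX`, with `k` constant. -/
def vAlong {U V : Orb G} (f : U ⟶ V) : (vSimplex v hv U).obj ⟶ (vSimplex v hv V).obj :=
  alongHom f (vSimplex_along hv f)

lemma alongHom_id {U : Orb G} {s : ESimplex X U 0} (h : s.along (𝟙 U) = s) :
    alongHom (𝟙 U) h = 𝟙 s.obj := rfl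

lemma vAlong_comp {U V W : Orb G} (f : U ⟶ V) (g : V ⟶ W) :
    vAlong hv (f ≫ g) = vAlong hv f ≫ vAlong hv g := by
  have h : (vSimplex v hv U).obj.point = X.precomp f (vSimplex v hv V).obj.point := by
    rw [← vSimplex_along hv f]
    exact point_along _ f
  refine Eq.symm ((FundGpd.homConst_comp (x := (vSimplex v hv U).obj)
    (y := (vSimplex v hv V).obj) (z := (vSimplex v hv W).obj) f h g _).trans ?_)
  refine congrArg (FundGpd.homMk (x := (vSimplex v hv U).obj) (y := (vSimplex v hv W).obj)
    (f ≫ g)) ?_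
  refine congrArg Path.Homotopic.Quotient.mk ?_
  exact Path.ext (funext fun t => h.symm)

/-- The homomorphism `b : π₁(X^H, v) → Aut (v_H)`, `[φ] ↦ [id, φ]`. -/
def bAut (U : Orb G) :
    FundamentalGroup |(X.fixed U.sub : SSet.{u})| (pt (vfix hv U)) →* Aut (vSimplex v hv U).obj where
  toFun α :=
    { hom := bHom (vSimplex_simplex hv U) (vSimplex_simplex hv U) α
      inv := bHom (vSimplex_simplex hv U) (vSimplex_simplex hv U) (inv α)
      hom_inv_id := by
        rw [← bHom_comp, IsIso.hom_inv_id, bHom_id]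
      inv_hom_id := by
        rw [← bHom_comp, IsIso.inv_hom_id, bHom_id] }
  map_one' := Iso.ext (bHom_id (vSimplex_simplex hv U))
  map_mul' α β := Iso.ext (bHom_comp (vSimplex_simplex hv U) (vSimplex_simplex hv U)
    (vSimplex_simplex hv U) β α)

lemma inv_vtx_congr {S : SSet.{u}} {x y : S _⦋0⦌} {α β : vtx x ⟶ vtx y} (h : α = β) :
    inv α = inv β := by
  subst h
  rfl

variable (M : LocalCoeff X)

/-- The abelian `O_G`-group `M₀`: `M₀(G ⧸ H) = M(v_H)`, `M₀(f) = M([f, k])`. -/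
def M0 : (Orb G)ᵒᵖ ⥤ AddCommGrpCat.{u} where
  obj U := M.obj (op (vSimplex v hv U.unop).obj)
  map f := M.map (vAlong hv f.unop).op
  map_id U := M.map_id _
  map_comp f g := by
    rw [← M.map_comp, ← op_comp, ← vAlong_comp]
    rfl

/-- The action of `π̲X` on `M₀`: `α ∈ π₁(X^H, v)` acts on `M(v_H)` as `M(bα)⁻¹`. -/
def M0act : OAction (piX hv) (M0 hv M) where
  act U :=
    { toFun := fun α => M.res (bAut hv U.unop α).inv
      map_one' := AddMonoidHom.ext fun m => by
        exact (congrArg (fun a : Aut _ => M.res a.inv m) (map_one (bAut hv U.unop))).trans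
          (M.res_id m)
      map_mul' := fun α β => AddMonoidHom.ext fun m => by
        refine (congrArg (fun a : Aut _ => M.res a.inv m) (map_mul (bAut hv U.unop) α β)).trans ?_
        exact (M.res_res _ _ m).symm }
  natural {U V} f α m := by
    change M.res (bAut hv V.unop ((piX hv).map f α)).inv (M.res (vAlong hv f.unop) m) =
      M.res (vAlong hv f.unop) (M.res (bAut hv U.unop α).inv m)
    let α' : vtx (vfix hv U.unop) ⟶ vtx (vfix hv U.unop) := α
    refine (M.res_res _ _ m).trans (Eq.trans ?_ (M.res_res _ _ m).symm)
    refine congrArg (fun p => M.res p m) ?_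
    refine Eq.trans ?_ (alongHom_bHom f.unop (vSimplex_simplex hv _) (vSimplex_simplex hv _)
      (vSimplex_simplex hv _) (vSimplex_simplex hv _) (vSimplex_along hv f.unop)
      (vSimplex_along hv f.unop) (fixedMap_vfix hv _) (fixedMap_vfix hv _) (inv α')).symm
    refine congrArg (· ≫ vAlong hv f.unop) ?_
    refine congrArg (bHom (vSimplex_simplex hv _) (vSimplex_simplex hv _))
      (Eq.trans ?_ (push_inv (X.fixedMap f.unop) (fixedMap_vfix hv _) (fixedMap_vfix hv _) α').symm)
    exact inv_vtx_congr (piX_map hv f α)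

end Base
end GSSet

namespace GSSet
open ESimplex
variable {X : GSSet G}

/-! ### The twisting function `κ` -/

lemma act_inv_eq {n : SimplexCategoryᵒᵖ} {g : G} {x y : X.V.obj n} (h : X.act g x = y) :
    X.act g⁻¹ y = x := by
  rw [← h, ← act_mul, inv_mul_cancel, act_one]

/-- The orbit `G ⧸ G_x`. -/
def stabOrb (X : GSSet G) (x : X.V _⦋0⦌) : Orb G := ⟨X.stab x⟩

/-- A vertex `x`, as a vertex of `X^{G_x}`. -/
def stabVertex (X : GSSet G) (x : X.V _⦋0⦌) : (X.fixed (X.stabOrb x).sub : SSet.{u}) _⦋0⦌ :=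
  ⟨x, fun _ hh => hh⟩

section Base
variable {v : X.V _⦋0⦌} (hv : ∀ g : G, X.act g v = v)

/-- The choices which `κ` depends on: a vertex `r` in each `G`-orbit of vertices, and for each of
them a path `ω_r` from `v` to `r` in `|X^{G_r}|`, that is, a `1`-simplex `ω_r` of `S|X^{G_r}|`
with `∂₁ ω_r = v` and `∂₀ ω_r = r`. -/
structure PathChoice where
  /-- the chosen vertices -/
  reps : Set (X.V _⦋0⦌)
  existsUnique_rep (x : X.V _⦋0⦌) : ∃! r, r ∈ reps ∧ ∃ g : G, X.act g r = x
  /-- the chosen paths -/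
  path (r : X.V _⦋0⦌) (hr : r ∈ reps) :
    Path (pt (vfix hv (X.stabOrb r))) (pt (X.stabVertex r))

namespace PathChoice
variable {hv} (c : PathChoice hv)

/-- The chosen vertex in the orbit of `x`. -/
def rep (x : X.V _⦋0⦌) : X.V _⦋0⦌ := (c.existsUnique_rep x).choose

lemma rep_mem (x : X.V _⦋0⦌) : c.rep x ∈ c.reps := (c.existsUnique_rep x).choose_spec.1.1

/-- An element `g` with `x = g r`, where `r` is the chosen vertex in the orbit of `x`. -/
def elt (x : X.V _⦋0⦌) : G := (c.existsUnique_rep x).choose_spec.1.2.choose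

lemma act_elt (x : X.V _⦋0⦌) : X.act (c.elt x) (c.rep x) = x :=
  (c.existsUnique_rep x).choose_spec.1.2.choose_spec

lemma eq_rep (x r : X.V _⦋0⦌) (hr : r ∈ c.reps) (g : G) (h : X.act g r = x) : r = c.rep x :=
  (c.existsUnique_rep x).choose_spec.2 r ⟨hr, g, h⟩

/-- For a vertex `x = g r` of `X^H`, the `G`-map `G ⧸ H → G ⧸ G_r`, `eH ↦ g G_r`. It induces the
simplicial map `g : X^{G_r} → X^H`, the composite of `g : X^{G_r} → X^{G_x}` and the inclusion. -/
def orbMap {U : Orb G} (x : (X.fixed U.sub : SSet.{u}) _⦋0⦌) : U ⟶ X.stabOrb (c.rep x.1) :=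
  Orb.ofElt (c.elt x.1) (by
    intro a ha
    change X.act _ _ = _
    rw [act_mul, act_mul, act_elt, x.2 a ha]
    exact act_inv_eq (c.act_elt x.1))

lemma fixedMap_orbMap {U : Orb G} (x : (X.fixed U.sub : SSet.{u}) _⦋0⦌) :
    (X.fixedMap (c.orbMap x)).app _ (X.stabVertex (c.rep x.1)) = x :=
  Subtype.ext ((X.fixedMap_val' _ _ (Orb.fn_ofElt _ _) _).trans (c.act_elt x.1))

/-- The class `ξ_H(x) : v → x` in the fundamental groupoid of `X^H` of the path `ω_x = g ω_r`,
where `x = g r` and `r` is the chosen vertex in the orbit of `x`. -/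
def xi {U : Orb G} (x : (X.fixed U.sub : SSet.{u}) _⦋0⦌) : vtx (vfix hv U) ⟶ vtx x :=
  push (X.fixedMap (c.orbMap x)) (fixedMap_vfix hv _) (c.fixedMap_orbMap x)
    (cls (c.path (c.rep x.1) (c.rep_mem x.1)))

lemma xi_eq {U : Orb G} (x : (X.fixed U.sub : SSet.{u}) _⦋0⦌) (r : X.V _⦋0⦌) (hr : r ∈ c.reps)
    (f : U ⟶ X.stabOrb r) (h : (X.fixedMap f).app _ (X.stabVertex r) = x) :
    c.xi x = push (X.fixedMap f) (fixedMap_vfix hv _) h (cls (c.path r hr)) := by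
  have h1 : X.act (Orb.elt f) r = x.1 := congrArg Subtype.val h
  obtain rfl := c.eq_rep x.1 r hr _ h1
  have h2 : f = c.orbMap x := by
    apply Orb.hom_ext
    refine (Orb.mk_elt f).symm.trans (Eq.trans ?_ (Orb.fn_ofElt _ _).symm)
    refine QuotientGroup.eq.2 ?_
    change X.act _ _ = _
    rw [act_mul, act_elt]
    exact act_inv_eq h1
  subst h2
  rfl

lemma xi_natural {U V : Orb G} (f : U ⟶ V) (x : (X.fixed V.sub : SSet.{u}) _⦋0⦌)
    {x' : (X.fixed U.sub : SSet.{u}) _⦋0⦌} (hx : (X.fixedMap f).app _ x = x') :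
    c.xi x' = push (X.fixedMap f) (fixedMap_vfix hv f) hx (c.xi x) := by
  have h : X.fixedMap (c.orbMap x) ≫ X.fixedMap f = X.fixedMap (f ≫ c.orbMap x) :=
    (X.Phi.map_comp (c.orbMap x).op f.op).symm
  have h2 : (X.fixedMap (f ≫ c.orbMap x)).app _ (X.stabVertex (c.rep x.1)) = x' := by
    rw [← h, ← hx]
    exact congrArg ((X.fixedMap f).app _) (c.fixedMap_orbMap x)
  refine (c.xi_eq x' _ (c.rep_mem x.1) (f ≫ c.orbMap x) h2).trans ?_
  exact (push_push _ _ _ h _ _ _ _ _ _ _).symm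

/-- The loop `ξ(y_j)⁻¹ ∘ [edge from y_i to y_j] ∘ ξ(y_i)` of an `n`-simplex `y` with vertices
`y_0, …, y_n`. -/
def loop {U : Orb G} {n : ℕ} (y : (X.fixed U.sub : SSet.{u}) _⦋n⦌) (i j : Fin (n + 1)) :
    vtx (vfix hv U) ⟶ vtx (vfix hv U) :=
  c.xi _ ≫ vPath y i j rfl rfl ≫ inv (c.xi _)

lemma loop_eq {U : Orb G} {n : ℕ} (y : (X.fixed U.sub : SSet.{u}) _⦋n⦌) (i j : Fin (n + 1))
    {a b} (ha : (X.fixed U.sub : SSet.{u}).map (SimplexCategory.const ⦋0⦌ ⦋n⦌ i).op y = a)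
    (hb : (X.fixed U.sub : SSet.{u}).map (SimplexCategory.const ⦋0⦌ ⦋n⦌ j).op y = b) :
    c.xi a ≫ vPath y i j ha hb ≫ inv (c.xi b) = c.loop y i j := by
  subst ha hb
  rfl

lemma loop_comp {U : Orb G} {n : ℕ} (y : (X.fixed U.sub : SSet.{u}) _⦋n⦌) (i j k : Fin (n + 1)) :
    c.loop y i j ≫ c.loop y j k = c.loop y i k := by
  unfold loop
  simp only [Category.assoc, IsIso.inv_hom_id_assoc]
  rw [← vPath_comp y i j k rfl rfl rfl, Category.assoc]

lemma loop_self {U : Orb G} {n : ℕ} (y : (X.fixed U.sub : SSet.{u}) _⦋n⦌) (i : Fin (n + 1)) :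
    c.loop y i i = 𝟙 _ := by
  unfold loop
  rw [vPath_self, Category.id_comp, IsIso.hom_inv_id]

lemma loop_map {U : Orb G} {m n : ℕ} (y : (X.fixed U.sub : SSet.{u}) _⦋n⦌) (θ : ⦋m⦌ ⟶ ⦋n⦌)
    (i j : Fin (m + 1)) :
    c.loop ((X.fixed U.sub : SSet.{u}).map θ.op y) i j = c.loop y (θ i) (θ j) := by
  refine Eq.trans ?_ (c.loop_eq y (θ i) (θ j) (map_const_map y θ i).symm (map_const_map y θ j).symm)
  unfold loop
  rw [vPath_map]

lemma loop_natural {U V : Orb G} (f : U ⟶ V) {n : ℕ} (y : (X.fixed V.sub : SSet.{u}) _⦋n⦌)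
    (i j : Fin (n + 1)) :
    c.loop ((X.fixedMap f).app _ y) i j =
      push (X.fixedMap f) (fixedMap_vfix hv f) (fixedMap_vfix hv f) (c.loop y i j) := by
  have hk := fun i : Fin (n + 1) =>
    (NatTrans.naturality_apply (X.fixedMap f) (SimplexCategory.const ⦋0⦌ ⦋n⦌ i).op y)
  unfold loop
  rw [push_comp _ _ (hk i) _, push_comp _ _ (hk j) _, push_inv, ← xi_natural, ← xi_natural]
  congr 2
  exact (push_simplexPath _ _ _ _ _ _ _ _ _).symm

/-- The value
`κ(G ⧸ H)(y) = ξ_H(∂_{(0,2,…,n+1)} y)⁻¹ ∘ [∂_{(2,…,n+1)} y] ∘ ξ_H(∂_{(1,…,n+1)} y)`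
at `y ∈ (X^H)_{n+1}`, an element of `π₁(X^H, v)`; the iterated faces are the vertex `1`, the edge
from the vertex `0` to the vertex `1`, and the vertex `0` of `y`. -/
def kappaVal {U : Orb G} {n : ℕ} (y : (X.fixed U.sub : SSet.{u}) _⦋n + 1⦌) :
    FundamentalGroup |(X.fixed U.sub : SSet.{u})| (pt (vfix hv U)) :=
  c.xi ((X.fixed U.sub : SSet.{u}).map (SimplexCategory.const ⦋0⦌ ⦋n + 1⦌ 0).op y) ≫
    edgeClass ((X.fixed U.sub : SSet.{u}).map (edge01 n).op y)
      (by
        change (X.fixed U.sub : SSet.{u}).map (SimplexCategory.δ 1).op _ = _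
        rw [SimplexCategory.δ_one_eq_const, map_const_map]
        rfl)
      (by
        change (X.fixed U.sub : SSet.{u}).map (SimplexCategory.δ 0).op _ = _
        rw [SimplexCategory.δ_zero_eq_const, map_const_map]
        rfl) ≫
    inv (c.xi ((X.fixed U.sub : SSet.{u}).map (SimplexCategory.const ⦋0⦌ ⦋n + 1⦌ 1).op y))

lemma kappaVal_eq {U : Orb G} {n : ℕ} (y : (X.fixed U.sub : SSet.{u}) _⦋n + 1⦌) :
    c.kappaVal y = c.loop y 0 1 := by
  unfold kappaVal loop
  rw [edgeClass_eq, vPath_map]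
  rfl

lemma kappaVal_map {U : Orb G} {m n : ℕ} (y : (X.fixed U.sub : SSet.{u}) _⦋n⦌)
    (θ : ⦋m + 1⦌ ⟶ ⦋n⦌) {i j : Fin (n + 1)} (hi : θ 0 = i) (hj : θ 1 = j) :
    c.kappaVal ((X.fixed U.sub : SSet.{u}).map θ.op y) = c.loop y i j := by
  subst hi hj
  rw [kappaVal_eq, loop_map]

lemma kappaVal_natural {U V : Orb G} (f : U ⟶ V) {n : ℕ}
    (y : (X.fixed V.sub : SSet.{u}) _⦋n + 1⦌) :
    c.kappaVal ((X.fixedMap f).app _ y) =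
      push (X.fixedMap f) (fixedMap_vfix hv f) (fixedMap_vfix hv f) (c.kappaVal y) := by
  rw [kappaVal_eq, kappaVal_eq]
  exact c.loop_natural f y 0 1

/-- The `O_G`-twisting function `κ : ΦX → π̲X`. -/
def kappa : OTwistingFunction X.Phi (trivialComplex (piX hv)) where
  tw U :=
    { toFun := fun n y => c.kappaVal (U := U.unop) y
      face_zero := fun q b => by
        have h0 : c.kappaVal (U := U.unop) ((X.Phi.obj U).δ 0 b) = c.loop (U := U.unop) b 1 2 :=
          c.kappaVal_map (U := U.unop) b (SimplexCategory.δ 0) rfl rfl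
        have h1 : c.kappaVal (U := U.unop) ((X.Phi.obj U).δ 1 b) = c.loop (U := U.unop) b 0 2 :=
          c.kappaVal_map (U := U.unop) b (SimplexCategory.δ 1) rfl rfl
        have h2 : c.kappaVal (U := U.unop) b = c.loop (U := U.unop) b 0 1 := c.kappaVal_eq _
        have h3 : (c.kappaVal (U := U.unop) ((X.Phi.obj U).δ 0 b)) *
            c.kappaVal (U := U.unop) b = c.kappaVal (U := U.unop) ((X.Phi.obj U).δ 1 b) := by
          rw [h0, h1, h2]
          exact c.loop_comp (U := U.unop) b 0 1 2
        exact eq_inv_mul_of_mul_eq h3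
      face_succ := fun q i b => by
        have h1 : c.kappaVal (U := U.unop) ((X.Phi.obj U).δ i.succ.succ b) =
            c.loop (U := U.unop) b 0 1 :=
          c.kappaVal_map (U := U.unop) b (SimplexCategory.δ i.succ.succ) rfl rfl
        exact (c.kappaVal_eq (U := U.unop) b).trans h1.symm
      degen := fun q i b => by
        have h1 : c.kappaVal (U := U.unop) ((X.Phi.obj U).σ i.succ b) =
            c.loop (U := U.unop) b 0 1 :=
          c.kappaVal_map (U := U.unop) b (SimplexCategory.σ i.succ) rfl rfl
        exact (c.kappaVal_eq (U := U.unop) b).trans h1.symm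
      degen_zero := fun q b => by
        have h1 : c.kappaVal (U := U.unop) ((X.Phi.obj U).σ 0 b) =
            c.loop (U := U.unop) b 0 0 :=
          c.kappaVal_map (U := U.unop) b (SimplexCategory.σ 0) rfl rfl
        exact h1.trans (c.loop_self (U := U.unop) b 0) }
  natural {U V} f q b := by
    change c.kappaVal (U := V.unop) ((X.fixedMap f.unop).app _ b) =
      (piX hv).map f (c.kappaVal (U := U.unop) b)
    exact (c.kappaVal_natural f.unop b).trans (piX_map hv f _).symm

end PathChoice
end Base

/-! ### The two cohomologies -/

/-- The simplicial Bredon–Illman cohomology `H_G^n(X; M)`. -/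
abbrev BICohomology (X : GSSet G) (M : LocalCoeff X) (n : ℕ) : AddCommGrpCat.{u} :=
  (BIComplex X M).homology n

/-- The equivariant twisted cohomology `H_G^n(X; κ, φ)`. -/
abbrev TwCohomology {X : GSSet G} {P : (Orb G)ᵒᵖ ⥤ GrpCat.{u}} {A : (Orb G)ᵒᵖ ⥤ AddCommGrpCat.{u}}
    (κ : OTwistingFunction X.Phi (trivialComplex P)) (φ : OAction P A) (n : ℕ) :
    AddCommGrpCat.{u} :=
  (TwComplex κ φ).homology n

end GSSet

end EqLC
end

open EqLC EqLC.GSSet EqLC.ESimplex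

noncomputable section
namespace EqLC
variable {G : Type u} [Group G]

/-! ### Connectedness and the existence of path choices -/

/-! An equivariant simplex `σ` of type `H` is determined by the simplex `y = σ(eH, Δₙ)` of `X^H`,
and every simplex of `X^H` arises in this way. Both complexes therefore consist of functions on the
simplices of all the `X^H` which vanish on degenerate simplices and are compatible with the maps of
orbits. They differ in where the values lie: in `M(σ_H)`, the group at the vertex 0 of `σ`, or in
`M(v_H)`, the group at the base vertex. The chosen paths give isomorphisms `bξ_H(x) : v_H → x_H` of
`ΠX`; `Ψ` is transport of values by `M(bξ)`, and `Γ` is transport by `M(bξ⁻¹)`. They are mutually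
inverse because `b` is functorial on the fundamental groupoid of `X^H`.

Two points carry the argument. The first is naturality over the orbit category. Since `ω_{gx} = g
ω_x`, the morphisms `bξ` commute with the morphisms `[f, k]` (`bXi_comp_alongHom`, and
`alongHom_comp_bXiInv` for the inverses). Hence `Ψ f` is a natural transformation and `Γ f`
satisfies the compatibility required in `BI`.

The second is the coboundary. For `j ≥ 1` the face `σ^{(j)}` has the same vertex 0 as `σ`, so both
sides are transported by the same morphism. The face `σ^{(0)}` starts at the vertex 1, and each
coboundary corrects for this: one by `M(σ_*)`, the other by the action of `κ(y)⁻¹`. By construction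
`ξ(y₁) ∘ κ(y) = [edge y₀y₁] ∘ ξ(y₀)`; applying `b` (`bHom_kappaVal_comp_bXi`) and then the
contravariant `M` gives `M(bκ(y)) M(bξ(y₁)) = M(bξ(y₀)) M(σ_*)`. As `α` acts by `M(bα)⁻¹`, the
element `κ(y)⁻¹` acts by `M(bκ(y))`, and the two corrections agree (`twDelta_psi`).

The existence of the paths is the contribution of `G`-connectedness: `v` and `x` both lie in the
connected `X^{G_x}`. -/

/-- Equality in `π₀` is the equivalence relation generated by the edges of `S`. An edge realizes to
a path of `|S|`, and paths of `|S|` can be reversed and concatenated even though edges of `S` in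
general cannot. -/
lemma joined_pt_of_isPreconnected {S : SSet.{u}} [S.IsPreconnected] (x y : S _⦋0⦌) :
    Joined (pt x) (pt y) := by
  have h : SSet.π₀.mk x = SSet.π₀.mk y := Subsingleton.elim _ _
  rw [SSet.π₀.mk_eq_mk_iff] at h
  induction h with
  | rel x y e =>
    obtain ⟨e⟩ := e
    exact ⟨edgePath e.edge e.src_eq e.tgt_eq⟩
  | refl x => exact Joined.refl _
  | symm x y _ ih => exact ih.symm
  | trans x y z _ _ ih ih' => exact ih.trans ih'

namespace GSSet
variable {X : GSSet G}

variable (X) in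
/-- Two vertices are equivalent when they lie in the same `G`-orbit. -/
def vertexSetoid : Setoid (X.V _⦋0⦌) where
  r x y := ∃ g : G, X.act g x = y
  iseqv :=
    { refl := fun x => ⟨1, X.act_one x⟩
      symm := fun ⟨g, h⟩ => ⟨g⁻¹, act_inv_eq h⟩
      trans := fun ⟨g, h⟩ ⟨g', h'⟩ => ⟨g' * g, by rw [act_mul, h, h']⟩ }

/-- The representatives come from a section of the quotient by the orbit relation. The paths exist
because both `v` and `r` are vertices of `X^{G_r}`, which is connected by hypothesis. -/
lemma GConnected.nonempty_pathChoice (hX : X.GConnected) {v : X.V _⦋0⦌}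
    (hv : ∀ g : G, X.act g v = v) : Nonempty (PathChoice hv) := by
  have hpath (r : X.V _⦋0⦌) : Joined (pt (vfix hv (X.stabOrb r))) (pt (X.stabVertex r)) :=
    haveI := hX (X.stabOrb r).sub
    joined_pt_of_isPreconnected _ _
  refine ⟨{
    reps := Set.range fun q : Quotient X.vertexSetoid => q.out
    existsUnique_rep := fun x => ⟨(Quotient.mk X.vertexSetoid x).out,
      ⟨⟨_, rfl⟩, Quotient.exact (Quotient.out_eq (Quotient.mk X.vertexSetoid x))⟩, ?_⟩
    path := fun r _ => (hpath r).somePath }⟩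
  -- Uniqueness: a representative in the orbit of `x` is the value of the section at a class `q`,
  -- and `q` must be the class of `x`.
  rintro _ ⟨⟨q, rfl⟩, hq⟩
  have h : Quotient.mk X.vertexSetoid q.out = Quotient.mk X.vertexSetoid x := Quotient.sound hq
  rw [← h, Quotient.out_eq]

end GSSet

/-! ### The equivariant simplex of a simplex of a fixed point set -/

namespace ESimplex
open GSSet
variable {X : GSSet G} {U V : Orb G} {n : ℕ}

/-- The equivariant simplex `G ⧸ H × Δ[n] → X`, `(gH, Δₙ) ↦ g y`, of a simplex `y` of `X^H`. -/
def ofSimplex (y : (X.fixed U.sub : SSet.{u}) _⦋n⦌) : ESimplex X U n where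
  hom :=
    { app := fun m => ↾fun p => X.V.map (SSet.stdSimplex.objEquiv
        (show U.coset × (SSet.stdSimplex.{u}.obj ⦋n⦌).obj m from p).2).op
          (X.act (Quotient.out (show U.coset × (SSet.stdSimplex.{u}.obj ⦋n⦌).obj m from p).1) y.1)
      naturality := fun m m' θ => by
        ext p
        change X.V.map _ _ = X.V.map θ (X.V.map _ _)
        rw [← Functor.map_comp_apply]
        rfl }
  comm g := by
    ext m p
    obtain ⟨a, s⟩ := (show U.coset × (SSet.stdSimplex.{u}.obj ⦋n⦌).obj m from p)
    change X.V.map (SSet.stdSimplex.objEquiv s).op (X.act (Quotient.out (g • a)) y.1) =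
      X.act g (X.V.map (SSet.stdSimplex.objEquiv s).op (X.act (Quotient.out a) y.1))
    rw [act_map, ← act_mul]
    -- The chosen representatives of `g • a` and of `a` need not differ by `g`, but `out (g • a)`
    -- and `g * out a` lie in the same coset of `H`. They act alike on `y`, which is fixed by `H`.
    refine congrArg _ (X.act_eq_of_mk_eq (V := U) ?_ _ y.2)
    exact (Quotient.out_eq _).trans (congrArg (fun b : U.coset => g • b) (Quotient.out_eq a)).symm

/-- The top simplex of `Δ[n]` corresponds to the identity of `⦋n⦌`, and the chosen representative of
`eH`, which may differ from `1`, lies in `H` and so fixes `y`. -/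
lemma simplex_ofSimplex (y : (X.fixed U.sub : SSet.{u}) _⦋n⦌) : (ofSimplex y).simplex = y := by
  apply Subtype.ext
  change X.V.map (𝟙 ⦋n⦌ : ⦋n⦌ ⟶ ⦋n⦌).op (X.act (Quotient.out U.base) y.1) = y.1
  rw [op_id, Functor.map_id_apply]
  exact (X.act_eq_of_mk_eq (V := U) (Quotient.out_eq _) _ y.2).trans (X.act_one _)

/-- An equivariant simplex is determined by its value at `(eH, Δₙ)`, so the right inverse of
`simplex` is two-sided. -/
lemma ofSimplex_simplex (σ : ESimplex X U n) : ofSimplex σ.simplex = σ :=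
  simplex_injective (simplex_ofSimplex _)

/-! ### Edges of an equivariant simplex as morphisms `bα` -/

/-- Both sides are built from the same path in `Δⁿ`: on the left it is realized directly in the
`G`-maps `G ⧸ H → |X|`, on the right first in `|X^H|`. A `G`-map on an orbit is determined by its
value at `eH`, and there the two agree because characteristic maps are compatible with the inclusion
of `X^H` in `X`. -/
lemma vHom_eq_bHom (σ : ESimplex X U n) (i j : Fin (n + 1)) {s t : ESimplex X U 0}
    (hs : σ.face (SimplexCategory.const ⦋0⦌ ⦋n⦌ i) = s)
    (ht : σ.face (SimplexCategory.const ⦋0⦌ ⦋n⦌ j) = t)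
    {x y : (X.fixed U.sub : SSet.{u}) _⦋0⦌}
    (hx : (X.fixed U.sub : SSet.{u}).map (SimplexCategory.const ⦋0⦌ ⦋n⦌ i).op σ.simplex = x)
    (hy : (X.fixed U.sub : SSet.{u}).map (SimplexCategory.const ⦋0⦌ ⦋n⦌ j).op σ.simplex = y)
    (hsx : s.simplex = x) (hty : t.simplex = y) :
    σ.vHom i j hs ht = bHom hsx hty (vPath σ.simplex i j hx hy) := by
  refine congrArg (FundGpd.homMk (x := s.obj) (y := t.obj) (𝟙 U)) ?_
  refine congrArg Path.Homotopic.Quotient.mk ?_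
  refine Path.ext (funext fun r => OrbitMap.ext_base (U := U) ?_)
  refine Eq.trans ?_ (jMap_base U _).symm
  exact (map_chi (X.fixed U.sub).ι σ.simplex _).symm

/-- This places the correction `σ_*` of the Bredon–Illman coboundary in the fundamental groupoid of
`X^H`, where it can be compared with the loop `κ`. The particular path along the edge is immaterial,
because `Δⁿ⁺¹` is simply connected. -/
lemma star_eq_bHom (σ : ESimplex X U (n + 1)) :
    σ.star = bHom rfl rfl (vPath σ.simplex 0 1 (σ.simplex_face _).symm
      ((σ.simplex_face _).symm.trans
        (congrArg simplex (σ.face_const (SimplexCategory.δ 0) 0).symm))) := by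
  unfold star
  rw [edgeHom_eq, vHom_face]
  exact vHom_eq_bHom _ _ _ _ _ _ _ _ _

end ESimplex

namespace GSSet
open ESimplex
variable {X : GSSet G} {v : X.V _⦋0⦌} {hv : ∀ g : G, X.act g v = v} {M : LocalCoeff X}

lemma bHom_hom_inv {U : Orb G} {s t : ESimplex X U 0} {x y : (X.fixed U.sub : SSet.{u}) _⦋0⦌}
    (hs : s.simplex = x) (ht : t.simplex = y) (α : vtx x ⟶ vtx y) :
    bHom hs ht α ≫ bHom ht hs (inv α) = 𝟙 s.obj := by
  rw [← bHom_comp, IsIso.hom_inv_id, bHom_id]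

lemma bHom_inv_hom {U : Orb G} {s t : ESimplex X U 0} {x y : (X.fixed U.sub : SSet.{u}) _⦋0⦌}
    (hs : s.simplex = x) (ht : t.simplex = y) (α : vtx x ⟶ vtx y) :
    bHom ht hs (inv α) ≫ bHom hs ht α = 𝟙 t.obj := by
  rw [← bHom_comp, IsIso.inv_hom_id, bHom_id]

/-! ### The isomorphism of cochain complexes -/

/-- `CochainComplex.of` defines its differential by a case distinction on degrees; this lemma and
the next resolve it between consecutive degrees, so that the comparison of the complexes becomes an
identity between cochains. -/
lemma BIComplex_d (M : LocalCoeff X) (n : ℕ) : (BIComplex X M).d n (n + 1) =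
    AddCommGrpCat.ofHom (((coboundary n).comp (BI X M n).subtype).codRestrict
      (BI X M (n + 1)) fun f => coboundary_mem f.1 f.2) :=
  CochainComplex.of_d (fun n => AddCommGrpCat.of (BI X M n)) (fun n => AddCommGrpCat.ofHom
    (((coboundary n).comp (BI X M n).subtype).codRestrict (BI X M (n + 1))
      fun f => coboundary_mem f.1 f.2)) n

lemma TwComplex_d {B : (Orb G)ᵒᵖ ⥤ SSet.{u}} {P : (Orb G)ᵒᵖ ⥤ GrpCat.{u}}
    {A : (Orb G)ᵒᵖ ⥤ AddCommGrpCat.{u}} (κ : OTwistingFunction B (trivialComplex P))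
    (φ : OAction P A) (n : ℕ) :
    (TwComplex κ φ).d n (n + 1) = AddCommGrpCat.ofHom (twDelta κ φ n) :=
  CochainComplex.of_d (fun n => AddCommGrpCat.of (TwCoch B A n))
    (fun n => AddCommGrpCat.ofHom (twDelta κ φ n)) n

/-! ### Transport along the chosen paths; the maps `Ψ` and `Γ` -/

namespace PathChoice
variable (c : PathChoice hv)

/-- The morphism `b ξ_H(x) : v_H → x_H` of `ΠX`, for an equivariant `0`-simplex `x_H`. -/
def bXi {U : Orb G} (s : ESimplex X U 0) : (vSimplex v hv U).obj ⟶ s.obj :=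
  bHom (vSimplex_simplex hv U) rfl (c.xi s.simplex)

/-- The morphism `b ξ_H(x)⁻¹ : x_H → v_H` of `ΠX`. -/
def bXiInv {U : Orb G} (s : ESimplex X U 0) : s.obj ⟶ (vSimplex v hv U).obj :=
  bHom rfl (vSimplex_simplex hv U) (inv (c.xi s.simplex))

lemma bXi_comp_bXiInv {U : Orb G} (s : ESimplex X U 0) : c.bXi s ≫ c.bXiInv s = 𝟙 _ :=
  bHom_hom_inv _ _ _

lemma bXiInv_comp_bXi {U : Orb G} (s : ESimplex X U 0) : c.bXiInv s ≫ c.bXi s = 𝟙 _ :=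
  bHom_inv_hom _ _ _

/-- Needed for the faces `σ^{(j)}`, `j ≥ 1`: their initial vertex equals that of `σ` only
propositionally, so the coboundary of `S_G(X; M)` contains transports along this equality. -/
lemma bXi_comp_eqToHom {U : Orb G} {s t : ESimplex X U 0} (h : s = t) :
    c.bXi s ≫ eqToHom (congrArg obj h) = c.bXi t := by
  subst h
  rw [eqToHom_refl, Category.comp_id]

/-- The translate by `f` of the path chosen for the vertex `t` is the path chosen for the translated
vertex; this is `xi_natural`, which expresses `ω_{gx} = g ω_x`. Moving it past the constant morphism
`[f, k]` is `alongHom_bHom`. -/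
lemma bXi_comp_alongHom {U V : Orb G} (f : U ⟶ V) {s : ESimplex X U 0} {t : ESimplex X V 0}
    (h : t.along f = s) : c.bXi s ≫ alongHom f h = vAlong hv f ≫ c.bXi t := by
  have hx : (X.fixedMap f).app _ t.simplex = s.simplex := by rw [← h, simplex_along]
  unfold bXi vAlong
  rw [c.xi_natural f t.simplex hx]
  exact (alongHom_bHom _ _ _ _ _ _ _ _ _ _).symm

/-- The previous square, composed with the inverses of its two morphisms `bξ`. It gives for `Γ` what
that square gives for `Ψ`. -/
lemma alongHom_comp_bXiInv {U V : Orb G} (f : U ⟶ V) {s : ESimplex X U 0} {t : ESimplex X V 0}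
    (h : t.along f = s) : alongHom f h ≫ c.bXiInv t = c.bXiInv s ≫ vAlong hv f := by
  have h1 := congrArg (fun p => c.bXiInv s ≫ p ≫ c.bXiInv t) (c.bXi_comp_alongHom f h)
  simp only [Category.assoc, bXi_comp_bXiInv, Category.comp_id] at h1
  rw [← h1, ← Category.assoc, bXiInv_comp_bXi, Category.id_comp]

/-- The key identity: `κ` is the composite of `ξ(y₀)`, the edge from `y₀` to `y₁`, and `ξ(y₁)⁻¹`, so
following it by `ξ(y₁)` leaves the edge after `ξ(y₀)`. Under `b` the edge becomes `σ_*`. -/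
lemma bHom_kappaVal_comp_bXi {U : Orb G} {n : ℕ} (σ : ESimplex X U (n + 1)) :
    bHom (vSimplex_simplex hv U) (vSimplex_simplex hv U) (c.kappaVal σ.simplex) ≫
      c.bXi (σ.del 0).init = c.bXi σ.init ≫ σ.star := by
  -- The initial vertex of `σ^{(0)}` is the vertex 1 of `σ`, since `δ₀` sends `0` to `1`. With `hk`,
  -- `κ` can be written with the end points that occur in the statement.
  have hk : (X.fixed U.sub : SSet.{u}).map (SimplexCategory.const ⦋0⦌ ⦋n + 1⦌ 1).op σ.simplex =
      (σ.del 0).init.simplex :=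
    (σ.simplex_face _).symm.trans
      (congrArg simplex (σ.face_const (SimplexCategory.δ 0) 0).symm)
  have h : c.kappaVal σ.simplex =
      c.xi σ.init.simplex ≫ vPath σ.simplex 0 1 (σ.simplex_face _).symm hk ≫
        inv (c.xi (σ.del 0).init.simplex) :=
    (c.kappaVal_eq _).trans (c.loop_eq _ _ _ _ _).symm
  unfold bXi
  rw [h, star_eq_bHom, ← bHom_comp, ← bHom_comp]
  simp only [Category.assoc, IsIso.inv_hom_id, Category.comp_id]

/-- The value `M(b ξ_H(σ_H)) f(σ)` of the cochain `Ψ f` at `σ`. -/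
def psiVal {n : ℕ} (f : Coch X M n) (U : Orb G) (σ : ESimplex X U n) :
    M.obj (op (vSimplex v hv U).obj) :=
  M.res (c.bXi σ.init) (f U σ)

/-- The compatibility of `f` along `φ` introduces `M([φ, k])` at the initial vertices; the square
for `bξ` moves it to the base vertices. -/
lemma psiVal_along {n : ℕ} {f : Coch X M n} (hf : f ∈ BI X M n) {U V : Orb G} (φ : U ⟶ V)
    (σ : ESimplex X V n) :
    c.psiVal f U (σ.along φ) = M.res (vAlong hv φ) (c.psiVal f V σ) := by
  unfold psiVal
  rw [hf.2, LocalCoeff.res_res, LocalCoeff.res_res]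
  exact congrArg (fun p => M.res p (f V σ)) (c.bXi_comp_alongHom φ (σ.init_along φ))

lemma psiVal_natural {n : ℕ} (f : BI X M n) {U V : (Orb G)ᵒᵖ} (g : U ⟶ V)
    (y : X.Phi.obj U _⦋n⦌) :
    c.psiVal f.1 V.unop (ofSimplex ((X.Phi.map g).app _ y)) =
      (M0 hv M).map g (c.psiVal f.1 U.unop (ofSimplex y)) := by
  refine Eq.trans ?_ (c.psiVal_along f.2 g.unop (ofSimplex (U := U.unop) y))
  -- The equivariant simplex of the translate of `y` is the one of `y` precomposed with the map of
  -- orbits, as comparison of the underlying simplices shows.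
  refine congrArg (c.psiVal f.1 V.unop) (simplex_injective ?_)
  refine (simplex_ofSimplex _).trans (Eq.trans ?_ (simplex_along _ _).symm)
  exact congrArg ((X.fixedMap g.unop).app _) (simplex_ofSimplex (U := U.unop) y).symm

/-- The cochain `Ψ f`. -/
def psi {n : ℕ} (f : BI X M n) : TwCoch X.Phi (M0 hv M) n :=
  TwCoch.mk (fun U y => c.psiVal f.1 U.unop (ofSimplex y))
    (fun U y hy => by
      -- Degeneracy refers to the underlying simplex, which is `y` by `simplex_ofSimplex`.
      have h : (ofSimplex (U := U.unop) y).Degenerate := by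
        refine Eq.subst (motive := (· ∈ SSet.degenerate _ n)) (simplex_ofSimplex _).symm hy
      exact (congrArg (M.res _) (f.2.1 _ _ h)).trans (map_zero _))
    (fun g y => c.psiVal_natural f g y)

/-- Every simplex of `X^H` has the form `σ.simplex`, so this formula determines `Ψ f`; later
computations use it in place of `ofSimplex`. -/
lemma psi_ev {n : ℕ} (f : BI X M n) {U : Orb G} (σ : ESimplex X U n) :
    (c.psi f).ev (op U) σ.simplex = c.psiVal f.1 U σ := by
  refine (TwCoch.mk_ev (B := X.Phi) _ _ (c.psiVal_natural f) (op U) σ.simplex).trans ?_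
  exact congrArg (c.psiVal f.1 U) (ofSimplex_simplex σ)

/-- The value `M(b ξ_H(σ_H)⁻¹) f(G ⧸ H)(σ')` of the cochain `Γ f` at `σ`. -/
def gammaVal {n : ℕ} (f : TwCoch X.Phi (M0 hv M) n) : Coch X M n :=
  fun U σ => M.res (c.bXiInv σ.init) (f.ev (op U) σ.simplex)

lemma gammaVal_mem {n : ℕ} (f : TwCoch X.Phi (M0 hv M) n) : c.gammaVal f ∈ BI X M n := by
  refine ⟨fun U σ h => ?_, fun U V φ τ => ?_⟩
  · exact (congrArg (M.res _) (f.ev_degenerate (op U) h)).trans (map_zero _)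
  · have h : f.ev (op U) (τ.along φ).simplex = M.res (vAlong hv φ) (f.ev (op V) τ.simplex) := by
      rw [simplex_along]
      exact f.ev_map φ.op τ.simplex
    unfold gammaVal
    rw [h]
    refine (M.res_res _ _ _).trans (Eq.trans ?_ (M.res_res _ _ _).symm)
    exact congrArg (fun p => M.res p (f.ev (op V) τ.simplex))
      (c.alongHom_comp_bXiInv φ (τ.init_along φ)).symm

/-- The isomorphism `Ψ` in degree `n`, with inverse `Γ`. -/
def psiEquiv (M : LocalCoeff X) (n : ℕ) : BI X M n ≃+ TwCoch X.Phi (M0 hv M) n where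
  toFun := c.psi
  invFun f := ⟨c.gammaVal f, c.gammaVal_mem f⟩
  left_inv f := by
    refine Subtype.ext (funext fun U => funext fun σ => ?_)
    change M.res _ ((c.psi f).ev (op U) σ.simplex) = f.1 U σ
    rw [psi_ev]
    unfold psiVal
    -- `M` is contravariant: `Γ Ψ` transports by `M(bξ⁻¹) M(bξ)`, which is `M` of the path back to
    -- `v` followed by the path out again.
    rw [LocalCoeff.res_res, bXiInv_comp_bXi, LocalCoeff.res_id]
  right_inv f := by
    refine TwCoch.ext_ev fun U y => ?_
    -- Replacing `y` by the underlying simplex of an equivariant one makes `psi_ev` applicable.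
    obtain ⟨σ, rfl⟩ : ∃ σ : ESimplex X U.unop n, σ.simplex = y := ⟨_, simplex_ofSimplex y⟩
    refine (c.psi_ev _ σ).trans ?_
    change M.res (c.bXi σ.init) (M.res (c.bXiInv σ.init) (f.ev U σ.simplex)) = f.ev U σ.simplex
    refine (M.res_res _ _ _).trans ?_
    rw [bXi_comp_bXiInv]
    exact M.res_id _
  map_add' f g := by
    refine TwCoch.ext_ev fun U y => ?_
    obtain ⟨σ, rfl⟩ : ∃ σ : ESimplex X U.unop n, σ.simplex = y := ⟨_, simplex_ofSimplex y⟩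
    refine (c.psi_ev _ σ).trans ((map_add _ _ _).trans ?_)
    exact (congrArg₂ (· + ·) (c.psi_ev f σ) (c.psi_ev g σ)).symm

/-! ### Compatibility of `Ψ` with the coboundaries -/

/-- Both sides are evaluated at the simplex of an equivariant `σ` and compared face by face: the
zeroth face by `bHom_kappaVal_comp_bXi`, the others by the equality of initial vertices. -/
lemma twDelta_psi {n : ℕ} (f : BI X M n) :
    twDelta c.kappa (M0act hv M) n (c.psi f) =
      c.psi ⟨coboundary n f.1, coboundary_mem f.1 f.2⟩ := by
  refine TwCoch.ext_ev fun U y => ?_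
  obtain ⟨U⟩ := U
  obtain ⟨σ, rfl⟩ : ∃ σ : ESimplex X U (n + 1), σ.simplex = y := ⟨_, simplex_ofSimplex y⟩
  have hface (j : Fin (n + 2)) : (c.psi f).ev (op U) ((X.Phi.obj (op U)).δ j σ.simplex) =
      c.psiVal f.1 U (σ.del j) :=
    (congrArg ((c.psi f).ev (op U)) (σ.simplex_face (SimplexCategory.δ j)).symm).trans
      (c.psi_ev f (σ.del j))
  refine (twDelta_ev c.kappa (M0act hv M) (c.psi f) (op U) σ.simplex).trans
    (Eq.trans ?_ (c.psi_ev _ σ).symm)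
  -- The transport `M(bξ(y₀))` is distributed over the terms of the coboundary of `f`, separating
  -- the zeroth face from the rest.
  refine Eq.trans ?_ (map_add (M.res (c.bXi σ.init)) _ _).symm
  refine congrArg₂ (· + ·) ?_ ?_
  · rw [hface]
    -- The action is by `M(bα)⁻¹`, so the inverse in the twisted coboundary cancels against it:
    -- `α⁻¹` acts as `M(bα)`.
    have hact (α : FundamentalGroup |(X.fixed U.sub : SSet.{u})| (pt (vfix hv U)))
        (m : M.obj (op (vSimplex v hv U).obj)) : (M0act hv M).act (op U) α⁻¹ m =
          M.res (bHom (vSimplex_simplex hv U) (vSimplex_simplex hv U) α) m := by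
      change M.res (bAut hv U α⁻¹).inv m = _
      rw [map_inv]
      rfl
    refine (hact _ _).trans ?_
    unfold psiVal
    rw [LocalCoeff.res_res, LocalCoeff.res_res]
    -- What remains is `M` of the two composites in the key identity, both from `v_H` to the vertex
    -- 1 of `σ`.
    exact congrArg (fun p => M.res p (f.1 U (σ.del 0))) (c.bHom_kappaVal_comp_bXi σ)
  · rw [map_sum]
    refine Finset.sum_congr rfl fun j _ => ?_
    rw [map_zsmul, hface, LocalCoeff.res_res, c.bXi_comp_eqToHom (σ.init_del_succ j).symm]
    rfl

/-- The isomorphism of cochain complexes `Ψ`, with inverse `Γ`. -/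
def complexIso (M : LocalCoeff X) : BIComplex X M ≅ TwComplex c.kappa (M0act hv M) :=
  HomologicalComplex.Hom.isoOfComponents
    (fun n => (c.psiEquiv M n).toAddCommGrpIso) (by
      rintro n _ rfl
      rw [BIComplex_d, TwComplex_d]
      -- Only `Ψ` has to be checked against the differentials; its degreewise inverse `Γ` is then a
      -- cochain map as well.
      exact AddCommGrpCat.hom_ext (AddMonoidHom.ext fun f => c.twDelta_psi f))

end PathChoice
end GSSet
end EqLC
end

/-! ### The theorem -/

theorem theorem4p7 {G : Type u} [Group G] (X : GSSet G) (hX : X.GConnected) {v : X.V _⦋0⦌}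
    (hv : ∀ g : G, X.act g v = v) (M : LocalCoeff X) :
    Nonempty (PathChoice hv) ∧
    ∀ c : PathChoice hv, ∃ e : BIComplex X M ≅ TwComplex c.kappa (M0act hv M),
      (∀ (n : ℕ) (f : BI X M n) (U : Orb G) (σ : ESimplex X U n), ¬ σ.Degenerate →
        TwCoch.ev ((e.hom.f n).hom f) (op U) σ.simplex =
          M.res (bHom (vSimplex_simplex hv U) rfl (c.xi σ.init.simplex)) (f.1 U σ)) ∧
      (∀ (n : ℕ) (f : TwCoch X.Phi (M0 hv M) n) (U : Orb G) (σ : ESimplex X U n), ¬ σ.Degenerate →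
        ((e.inv.f n).hom f : BI X M n).1 U σ =
          M.res (bHom rfl (vSimplex_simplex hv U) (inv (c.xi σ.init.simplex)))
            (TwCoch.ev f (op U) σ.simplex)) ∧
      ∀ n : ℕ, ∃ i : BICohomology X M n ≅ TwCohomology c.kappa (M0act hv M) n,
        i.hom = HomologicalComplex.homologyMap e.hom n := by
  refine ⟨hX.nonempty_pathChoice hv, fun c => ⟨c.complexIso M,
    -- The formula for `Γ` is the definition of the inverse in `psiEquiv`. That for `Ψ` needs
    -- `psi_ev`, because `psi` is defined through `ofSimplex`.
    fun n f U σ _ => c.psi_ev f σ, fun n f U σ _ => rfl,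
    fun n => ⟨HomologicalComplex.homologyMapIso (c.complexIso M) n, rfl⟩⟩⟩
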